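/- Let $K$ be an algebraically closed field of characteristic $0$, let $n \geq 2$, and let $\Gamma \subset \mathbb{P}^n = \mathbb{P}^n_K$ be a finite subscheme with ideal sheaf $\mathcal{I}_\Gamma$, of degree (that is, length) $d = h^0(\Gamma, \mathcal{O}_\Gamma) \geq 4n^2+6n+1$. Assume that $\Gamma$ is in linearly general position, i.e. the smallest integer $t \ge 0$ for which there is a $t$-dimensional linear subspace $\Lambda \subset \mathbb{P}^n$ such that the scheme-theoretic intersection $\Gamma \cap \Lambda$ has length at least $t+2$ is $t = n$. Write $d = nq+r+2$ with integers $q$ and $0 \leq r \leq n-1$. Then $$h^1(\mathbb{P}^n, \mathcal{I}_\Gamma(q)) \leq r+1.$$ Moreover, the following two statements are equivalent: (i) $\Gamma$ is contained (as a subscheme) in a rational normal curve of degree $n$ in $\mathbb{P}^n$; (ii) $h^1(\mathbb{P}^n, \mathcal{I}_\Gamma(q)) = r+1$. If, in addition, $\Gamma$ is a finite set of points (i.e. reduced) and $h^1(\mathbb{P}^n, \mathcal{I}_\Gamma(q)) > 0$, then the following two statements are equivalent: (i) $\Gamma$ is in uniform position, i.e. $\Gamma$ lies in no hyperplane and, with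 $h_Z(\ell)$ denoting the Hilbert function of a finite set $Z \subset \mathbb{P}^n$, one has $h_Y(\ell) = \min\{|Y|, h_\Gamma(\ell)\}$ for every subset $Y \subseteq \Gamma$ and every integer $\ell \geq 0$; (ii) $h^1(\mathbb{P}^n, \mathcal{I}_\Gamma(q)) = r+1$. -/

import Mathlib

open MvPolynomial
open scoped LinearAlgebra.Projectivization

noncomputable section

namespace ProjSpace

/-- The homogeneous coordinate ring `K[x₀, …, xₙ]` of `ℙⁿ`. -/
abbrev CoordRing (K : Type*) [Field K] (n : ℕ) : Type _ := MvPolynomial (Fin (n + 1)) K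

/-- The field of fractions of the homogeneous coordinate ring; all sections of the sheaves
`𝓘(q) ⊆ 𝓞(q)` over the open sets `D₊(x^a)` are elements of it. -/
abbrev Frac (K : Type*) [Field K] (n : ℕ) : Type _ := FractionRing (CoordRing K n)

variable {K : Type*} [Field K] {n : ℕ}

/-- For an ideal `J` of the coordinate ring with associated ideal sheaf `𝓙` on `ℙⁿ`, the space
`H⁰(D₊(x^a), 𝓙(q))`, i.e. the degree `q` part of the localization of `J` at the monomial `x^a`:
the fractions `f / (x^a)^k` with `f ∈ J` homogeneous of degree `q + k * |a|`. -/
def sections (J : Ideal (CoordRing K n)) (q : ℕ) (a : Fin (n + 1) →₀ ℕ) :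
    Submodule K (Frac K n) where
  carrier := {z | ∃ k : ℕ, ∃ f ∈ J, f.IsHomogeneous (q + k * a.degree) ∧
    z * algebraMap (CoordRing K n) (Frac K n) (monomial a 1 ^ k) =
      algebraMap (CoordRing K n) (Frac K n) f}
  zero_mem' := ⟨0, 0, J.zero_mem, isHomogeneous_zero _ _ _, by simp⟩
  add_mem' := by
    rintro y z ⟨k, f, hf, hfh, hy⟩ ⟨l, g, hg, hgh, hz⟩
    have hm : ∀ m : ℕ, (monomial a (1 : K) ^ m).IsHomogeneous (a.degree * m) := fun m =>
      (isHomogeneous_monomial (1 : K) rfl).pow m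
    refine ⟨k + l, f * monomial a 1 ^ l + g * monomial a 1 ^ k,
      J.add_mem (J.mul_mem_right _ hf) (J.mul_mem_right _ hg), ?_, ?_⟩
    · refine IsHomogeneous.add ?_ ?_
      · have h := hfh.mul (hm l)
        rwa [show q + k * a.degree + a.degree * l = q + (k + l) * a.degree by ring] at h
      · have h := hgh.mul (hm k)
        rwa [show q + l * a.degree + a.degree * k = q + (k + l) * a.degree by ring] at h
    · rw [map_add, map_mul, map_mul, ← hy, ← hz, pow_add, map_mul]
      ring
  smul_mem' := by
    rintro c z ⟨k, f, hf, hfh, hz⟩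
    refine ⟨k, c • f, ?_, ?_, ?_⟩
    · rw [smul_eq_C_mul]
      exact J.mul_mem_left _ hf
    · exact (homogeneousSubmodule (Fin (n + 1)) K _).smul_mem c hfh
    · rw [smul_mul_assoc, hz, Algebra.algebraMap_eq_smul_one, Algebra.algebraMap_eq_smul_one,
        smul_assoc]

/-- The exponent of `x_i`; its open set is `D₊(x_i)`. -/
abbrev chart (i : Fin (n + 1)) : Fin (n + 1) →₀ ℕ := Finsupp.single i 1

/-- The exponent of `x_i x_j`; its open set is `D₊(x_i) ∩ D₊(x_j)`. -/
abbrev overlap (i j : Fin (n + 1)) : Fin (n + 1) →₀ ℕ := chart i + chart j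

/-- Lifts of global sections of `𝓞/𝓙`: families of functions `s_i` on `D₊(x_i)` that agree modulo
`𝓙` on the overlaps. -/
def quotientCocycles (J : Ideal (CoordRing K n)) : Submodule K (Fin (n + 1) → Frac K n) where
  carrier := {s | (∀ i, s i ∈ sections ⊤ 0 (chart i)) ∧
    ∀ i j, s j - s i ∈ sections J 0 (overlap i j)}
  zero_mem' := ⟨fun _ => Submodule.zero_mem _, fun _ _ => by simp⟩
  add_mem' := by
    rintro s t ⟨hs, hs'⟩ ⟨ht, ht'⟩
    refine ⟨fun i => Submodule.add_mem _ (hs i) (ht i), fun i j => ?_⟩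
    have h := Submodule.add_mem _ (hs' i j) (ht' i j)
    rwa [show s j - s i + (t j - t i) = (s + t) j - (s + t) i by simp; ring] at h
  smul_mem' := by
    rintro c s ⟨hs, hs'⟩
    refine ⟨fun i => Submodule.smul_mem _ c (hs i), fun i j => ?_⟩
    have h := Submodule.smul_mem _ c (hs' i j)
    rwa [smul_sub] at h

/-- Families of sections of `𝓙` over the `D₊(x_i)`. -/
def quotientTrivial (J : Ideal (CoordRing K n)) : Submodule K (Fin (n + 1) → Frac K n) :=
  Submodule.pi Set.univ fun i => sections J 0 (chart i)

/-- The space `H⁰(ℙⁿ, 𝓞/𝓙)`: global sections of the structure sheaf of the closed subscheme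
defined by the ideal sheaf `𝓙` of `J`, glued from the affine charts. -/
abbrev StructureSections (J : Ideal (CoordRing K n)) : Type _ :=
  quotientCocycles J ⧸ (quotientTrivial J).submoduleOf (quotientCocycles J)

/-- The length `h⁰(𝓞/𝓙)` of the (finite) subscheme of `ℙⁿ` defined by the ideal sheaf of `J`. -/
def length (J : Ideal (CoordRing K n)) : ℕ∞ := Module.length K (StructureSections J)

/-- Čech 1-cocycles of `𝓙(q)` for the cover of `ℙⁿ` by the `D₊(x_i)`. -/
def cocycles (J : Ideal (CoordRing K n)) (q : ℕ) :
    Submodule K (Fin (n + 1) → Fin (n + 1) → Frac K n) where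
  carrier := {c | (∀ i j, c i j ∈ sections J q (overlap i j)) ∧
    ∀ i j k, c i j + c j k = c i k}
  zero_mem' := ⟨fun _ _ => Submodule.zero_mem _, fun _ _ _ => by simp⟩
  add_mem' := by
    rintro s t ⟨hs, hs'⟩ ⟨ht, ht'⟩
    refine ⟨fun i j => Submodule.add_mem _ (hs i j) (ht i j), fun i j k => ?_⟩
    simp only [Pi.add_apply, ← hs' i j k, ← ht' i j k]
    ring
  smul_mem' := by
    rintro c s ⟨hs, hs'⟩
    refine ⟨fun i j => Submodule.smul_mem _ c (hs i j), fun i j k => ?_⟩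
    simp only [Pi.smul_apply, ← hs' i j k, smul_add]

/-- Čech 1-coboundaries of `𝓙(q)` for the cover of `ℙⁿ` by the `D₊(x_i)`. -/
def coboundaries (J : Ideal (CoordRing K n)) (q : ℕ) :
    Submodule K (Fin (n + 1) → Fin (n + 1) → Frac K n) where
  carrier := {c | ∃ b : Fin (n + 1) → Frac K n,
    (∀ i, b i ∈ sections J q (chart i)) ∧ ∀ i j, c i j = b j - b i}
  zero_mem' := ⟨0, fun _ => Submodule.zero_mem _, fun _ _ => by simp⟩
  add_mem' := by
    rintro s t ⟨b, hb, hs⟩ ⟨b', hb', ht⟩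
    refine ⟨b + b', fun i => Submodule.add_mem _ (hb i) (hb' i), fun i j => ?_⟩
    simp only [Pi.add_apply, hs, ht]
    ring
  smul_mem' := by
    rintro c s ⟨b, hb, hs⟩
    refine ⟨c • b, fun i => Submodule.smul_mem _ c (hb i), fun i j => ?_⟩
    simp only [Pi.smul_apply, hs, smul_sub]

/-- The first cohomology `H¹(ℙⁿ, 𝓙(q))`, as Čech cohomology of the standard affine cover. -/
abbrev H1 (J : Ideal (CoordRing K n)) (q : ℕ) : Type _ :=
  cocycles J q ⧸ (coboundaries J q).submoduleOf (cocycles J q)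

/-- The dimension `h¹(ℙⁿ, 𝓙(q))`, with value `⊤` if it is infinite. -/
def h1 (J : Ideal (CoordRing K n)) (q : ℕ) : ℕ∞ := Module.length K (H1 J q)

/-- The Hilbert function of the ideal `J`: the dimension of the degree `ℓ` part of
`K[x₀, …, xₙ] / J`, i.e. of the image of the forms of degree `ℓ`. -/
def hilbertFunction (J : Ideal (CoordRing K n)) (ℓ : ℕ) : ℕ :=
  Module.finrank K
    ((homogeneousSubmodule (Fin (n + 1)) K ℓ).map (Ideal.Quotient.mkₐ K J).toLinearMap)

/-- A closed subscheme of `ℙⁿ`, given by its saturated homogeneous ideal. -/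
structure ClosedSubscheme (K : Type*) [Field K] (n : ℕ) where
  /-- The saturated homogeneous ideal of the subscheme. -/
  ideal : Ideal (CoordRing K n)
  homogeneous : ∀ f ∈ ideal, ∀ m : ℕ, homogeneousComponent m f ∈ ideal
  saturated : ∀ f : CoordRing K n, (∀ i, ∃ m : ℕ, X i ^ m * f ∈ ideal) → f ∈ ideal

namespace ClosedSubscheme

/-- Scheme-theoretic inclusion of closed subschemes. -/
instance : LE (ClosedSubscheme K n) := ⟨fun Γ C => C.ideal ≤ Γ.ideal⟩

/-- A closed subscheme is finite (over `K`) if the coordinate ring of each affine chart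
`Γ ∩ D₊(x_i)` is a finite-dimensional vector space. -/
def IsFinite (Γ : ClosedSubscheme K n) : Prop :=
  ∀ i : Fin (n + 1), Module.Finite K
    (sections (⊤ : Ideal (CoordRing K n)) 0 (chart i) ⧸
      (sections Γ.ideal 0 (chart i)).submoduleOf (sections ⊤ 0 (chart i)))

/-- The degree (length) of a finite subscheme. -/
def degree (Γ : ClosedSubscheme K n) : ℕ∞ := length Γ.ideal

/-- `Γ` admits a `(t + 2)`-secant `t`-plane: a `t`-dimensional linear subspace `Λ` of `ℙⁿ`, cut out
by an `(n - t)`-dimensional space `L` of linear forms, such that the scheme `Γ ∩ Λ` with ideal sheaf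
`𝓘_Γ + 𝓘_Λ` has length at least `t + 2`. -/
def HasSecantPlane (Γ : ClosedSubscheme K n) (t : ℕ) : Prop :=
  ∃ L : Submodule K (CoordRing K n), L ≤ homogeneousSubmodule (Fin (n + 1)) K 1 ∧
    Module.finrank K L + t = n ∧
    ((t + 2 : ℕ) : ℕ∞) ≤ length (Γ.ideal ⊔ Ideal.span (L : Set (CoordRing K n)))

/-- A finite subscheme of `ℙⁿ` is in linearly general position if the smallest `t` for which it
admits a `(t + 2)`-secant `t`-plane is `n`. -/
def IsInLinearlyGeneralPosition (Γ : ClosedSubscheme K n) : Prop :=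
  IsLeast {t : ℕ | Γ.HasSecantPlane t} n

/-- `C` is a rational normal curve (of degree `n`) in `ℙⁿ`: the image of `ℙ¹` under the map
`[F₀ : … : Fₙ]` given by a basis `F₀, …, Fₙ` of the binary forms of degree `n`, with its reduced
structure; its ideal consists of the polynomials that vanish on substituting the `F_i`. -/
def IsRationalNormalCurve (C : ClosedSubscheme K n) : Prop :=
  ∃ F : Fin (n + 1) → MvPolynomial (Fin 2) K, (∀ i, (F i).IsHomogeneous n) ∧
    LinearIndependent K F ∧ C.ideal = RingHom.ker (aeval F : CoordRing K n →ₐ[K] _)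

/-- `Γ` is (scheme-theoretically) contained in some rational normal curve of `ℙⁿ`. -/
def LiesOnRationalNormalCurve (Γ : ClosedSubscheme K n) : Prop :=
  ∃ C : ClosedSubscheme K n, C.IsRationalNormalCurve ∧ Γ ≤ C

end ClosedSubscheme

/-- The homogeneous ideal of a finite set of points of `ℙⁿ` (for infinite `K`): the polynomials
that vanish on the union of the lines in `Kⁿ⁺¹` corresponding to the points. -/
def pointsIdeal (Y : Finset (ℙ K (Fin (n + 1) → K))) : Ideal (CoordRing K n) :=
  vanishingIdeal K (⋃ p ∈ Y, (p.submodule : Set (Fin (n + 1) → K)))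

/-- A finite set of points of `ℙⁿ` is in uniform position if it is nondegenerate (lies in no
hyperplane) and every subset `Y` has Hilbert function `min (|Y|, h_S)`. -/
def IsInUniformPosition (S : Finset (ℙ K (Fin (n + 1) → K))) : Prop :=
  (∀ f ∈ pointsIdeal S, f.IsHomogeneous 1 → f = 0) ∧
    ∀ Y ⊆ S, ∀ ℓ : ℕ,
      hilbertFunction (pointsIdeal Y) ℓ = min Y.card (hilbertFunction (pointsIdeal S) ℓ)

end ProjSpace

end

/-!
Dehomogenizing at a linear form that vanishes nowhere on `Γ` turns `Γ` into `Spec A` for a finite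
algebra `A` of dimension `d`, and the linear forms into a subspace `V` of `A` containing `1`. Since
`H¹(ℙⁿ, 𝓞(q)) = 0`, the group `H¹(𝓘_Γ(q))` is the cokernel of the restriction of forms of degree `q`
to `Γ`, so `h¹(𝓘_Γ(q)) = d - h_Γ(q)`, where `h_Γ(q) = dim V ^ q`. Castelnuovo's bound
`h_Γ(k) ≥ min d (n k + 1)`, by induction on `k` through residual schemes with respect to
hyperplanes, gives the inequality.

On a rational normal curve `h_Γ(q) ≤ n q + 1`, whence equality. Conversely, if
`dim V ^ q = n q + 1`, choose a subscheme of `Γ` of length `n q + 2` on which `V ^ q` restricts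
injectively, hence to a hyperplane. The functional defining this hyperplane is dualizing on the
subscheme, which forces `dim V ^ 2 = 2 n + 1`. So the ratio `s / t` of two linear forms through
`n - 1` of the points is attained by an `n`-dimensional pencil of pairs of linear forms. Kronecker's
normal form of this pencil arranges a basis of `V` into a chain whose `2 × 2` minors vanish on `Γ`;
these are the equations of a rational normal curve.

The Hilbert function `h` of points in uniform position satisfies
`h (a + b) ≥ min d (h a + h b - 1)`. If moreover `h q < d`, then `h 3 = 3 n + 1`, which by the
converse above in degree `3` puts the points on a rational normal curve; the points of such a curve
are in uniform position because `h_Y(k) = min |Y| (n k + 1)` for all subsets `Y`.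
-/

noncomputable section

namespace ProjSpace

open Module

section FiniteAlgebra

variable {K A M M' : Type*} [Field K] [CommRing A] [Algebra K A]
  [AddCommGroup M] [Module K M] [AddCommGroup M'] [Module K M']

theorem finrank_map_add_finrank_inf_ker (f : M →ₗ[K] M') (U : Submodule K M) [Module.Finite K U] :
    finrank K (U.map f) + finrank K (U ⊓ LinearMap.ker f : Submodule K M) = finrank K U := by
  rw [← LinearMap.finrank_range_add_finrank_ker (f.domRestrict U), LinearMap.range_domRestrict,
    LinearMap.ker_domRestrict, ← Submodule.map_comap_subtype,
    Submodule.finrank_map_subtype_eq]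

theorem finrank_submodule_prod (U : Submodule K M) (W : Submodule K M') [Module.Finite K U]
    [Module.Finite K W] : finrank K (U.prod W) = finrank K U + finrank K W := by
  have hrange : U.prod W = LinearMap.range (U.subtype.prodMap W.subtype) := by
    rw [LinearMap.range_prodMap, Submodule.range_subtype, Submodule.range_subtype]
  rw [hrange, LinearMap.finrank_range_of_inj
    (Function.Injective.prodMap U.injective_subtype W.injective_subtype), finrank_prod]

theorem restrictScalars_span_singleton (v : A) :
    (Ideal.span {v}).restrictScalars K = LinearMap.range (LinearMap.mulLeft K v) := by
  ext x
  simp [Ideal.mem_span_singleton', mul_comm]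

theorem finrank_quotient_add_finrank_restrictScalars [Module A M] [IsScalarTower K A M]
    [Module.Finite K M] (P : Submodule A M) :
    finrank K (M ⧸ P) + finrank K (P.restrictScalars K) = finrank K M := by
  rw [← (Submodule.Quotient.restrictScalarsEquiv K P).finrank_eq]
  exact Submodule.finrank_quotient_add_finrank _

variable [Module.Finite K A]

theorem finrank_span_singleton_add_finrank_ker_mulLeft (v : A) :
    finrank K ((Ideal.span {v}).restrictScalars K) +
      finrank K (LinearMap.ker (LinearMap.mulLeft K v)) = finrank K A := by
  rw [restrictScalars_span_singleton, LinearMap.finrank_range_add_finrank_ker]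

theorem exists_ideal_finrank_eq_add_one [IsAlgClosed K] {I : Ideal A} (hI : I ≠ ⊤) :
    ∃ J : Ideal A, I ≤ J ∧
      finrank K (J.restrictScalars K) = finrank K (I.restrictScalars K) + 1 := by
  have : IsArtinianRing A := isArtinian_of_tower K inferInstance
  obtain ⟨J, hIJ⟩ := exists_covBy_of_wellFoundedLT (not_isMax_iff_ne_top.mpr hI)
  have : IsSimpleModule A (J ⧸ I.submoduleOf J) := (covBy_iff_quot_is_simple hIJ.le).mp hIJ
  have : Module.Finite K J := inferInstanceAs (Module.Finite K (J.restrictScalars K))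
  have hsimple : finrank K (J ⧸ I.submoduleOf J) = 1 :=
    IsSimpleModule.finrank_eq_one_of_isMulCommutative A _ K
  have hsub : finrank K ((I.submoduleOf J).restrictScalars K) = finrank K (I.restrictScalars K) :=
    ((Submodule.submoduleOfEquivOfLe hIJ.le).restrictScalars K).finrank_eq
  have hdim := finrank_quotient_add_finrank_restrictScalars (K := K) (I.submoduleOf J)
  rw [hsimple, hsub, add_comm] at hdim
  exact ⟨J, hIJ.le, hdim.symm⟩

theorem exists_ideal_finrank_eq [IsAlgClosed K] (I : Ideal A) {m : ℕ}
    (hIm : finrank K (I.restrictScalars K) ≤ m) (hm : m ≤ finrank K A) :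
    ∃ J : Ideal A, I ≤ J ∧ finrank K (J.restrictScalars K) = m := by
  induction m, hIm using Nat.le_induction with
  | base => exact ⟨I, le_rfl, rfl⟩
  | succ m _ ih =>
    obtain ⟨J, hIJ, hJ⟩ := ih (by omega)
    have hJtop : J ≠ ⊤ := by
      rintro rfl
      rw [Submodule.restrictScalars_top, finrank_top] at hJ
      omega
    obtain ⟨J', hJJ', hJ'⟩ := exists_ideal_finrank_eq_add_one (K := K) hJtop
    exact ⟨J', hIJ.trans hJJ', by omega⟩

theorem exists_ideal_finrank_eq_of_le [IsAlgClosed K] {m : ℕ} (hm : m ≤ finrank K A) :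
    ∃ J : Ideal A, finrank K (J.restrictScalars K) = m := by
  obtain ⟨J, -, hJ⟩ := exists_ideal_finrank_eq (K := K) (⊥ : Ideal A) (m := m)
    (by rw [Submodule.restrictScalars_bot, finrank_bot]; exact m.zero_le) hm
  exact ⟨J, hJ⟩

end FiniteAlgebra

section ResidualIdeal

variable {K A : Type*} [Field K] [CommRing A] [Algebra K A] {v : A} {I : Ideal A}

theorem map_mulLeft_colon (hI : I ≤ Ideal.span {v}) :
    ((I.colon {v}).restrictScalars K).map (LinearMap.mulLeft K v) = I.restrictScalars K := by
  ext x
  simp only [Submodule.mem_map, Submodule.restrictScalars_mem, Submodule.mem_colon_singleton,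
    LinearMap.mulLeft_apply, smul_eq_mul]
  constructor
  · rintro ⟨y, hy, rfl⟩
    rwa [mul_comm]
  · intro hx
    obtain ⟨y, rfl⟩ := Ideal.mem_span_singleton'.mp (hI hx)
    exact ⟨y, hx, mul_comm v y⟩

theorem ker_mulLeft_le_colon :
    LinearMap.ker (LinearMap.mulLeft K v) ≤ (I.colon {v}).restrictScalars K := by
  intro x hx
  rw [LinearMap.mem_ker, LinearMap.mulLeft_apply] at hx
  rw [Submodule.restrictScalars_mem, Submodule.mem_colon_singleton, smul_eq_mul, mul_comm, hx]
  exact I.zero_mem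

variable [Module.Finite K A]

theorem finrank_map_mulLeft_add {U : Submodule K A}
    (hU : LinearMap.ker (LinearMap.mulLeft K v) ≤ U) :
    finrank K (U.map (LinearMap.mulLeft K v)) + finrank K A =
      finrank K U + finrank K ((Ideal.span {v}).restrictScalars K) := by
  have hmap := finrank_map_add_finrank_inf_ker (LinearMap.mulLeft K v) U
  have hspan := finrank_span_singleton_add_finrank_ker_mulLeft (K := K) v
  rw [inf_eq_right.mpr hU] at hmap
  omega

theorem finrank_colon_add (hI : I ≤ Ideal.span {v}) :
    finrank K ((I.colon {v}).restrictScalars K) +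
        finrank K ((Ideal.span {v}).restrictScalars K) =
      finrank K (I.restrictScalars K) + finrank K A := by
  rw [← finrank_map_mulLeft_add ker_mulLeft_le_colon, map_mulLeft_colon hI]

theorem finrank_pow_sup_colon_add_le {V : Submodule K A} (hv : v ∈ V) (hI : I ≤ Ideal.span {v})
    (k : ℕ) :
    finrank K (V ^ k ⊔ (I.colon {v}).restrictScalars K : Submodule K A) +
        finrank K (V ^ (k + 1) ⊔ I.restrictScalars K ⊔ (Ideal.span {v}).restrictScalars K :
          Submodule K A) ≤
      finrank K (V ^ (k + 1) ⊔ I.restrictScalars K : Submodule K A) + finrank K A := by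
  have hmap := finrank_map_mulLeft_add (K := K) (v := v)
    (ker_mulLeft_le_colon.trans le_sup_right :
      _ ≤ V ^ k ⊔ (I.colon {v}).restrictScalars K)
  have hle : (V ^ k ⊔ (I.colon {v}).restrictScalars K).map (LinearMap.mulLeft K v) ≤
      (V ^ (k + 1) ⊔ I.restrictScalars K) ⊓ (Ideal.span {v}).restrictScalars K := by
    refine le_inf ?_ (restrictScalars_span_singleton (K := K) v ▸ LinearMap.map_le_range)
    rw [Submodule.map_sup, map_mulLeft_colon hI, pow_succ']
    refine sup_le_sup_right ?_ _
    rintro _ ⟨x, hx, rfl⟩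
    exact Submodule.mul_mem_mul hv hx
  have hmono := Submodule.finrank_mono hle
  have hsup := Submodule.finrank_sup_add_finrank_inf_eq (V ^ (k + 1) ⊔ I.restrictScalars K)
    ((Ideal.span {v}).restrictScalars K)
  omega

end ResidualIdeal

section LinearlyGeneralPosition

variable {K A : Type*} [Field K] [CommRing A] [Algebra K A]

/-- Linear general position on a finite scheme `Spec A`: the `(n + 1)`-dimensional space `V` of
functions contains the constants, and the subscheme of `Spec A` cut out by a subspace `W ≠ 0` of
`V`, which is the intersection with a plane of dimension `n - dim W`, has length at most
`n + 1 - dim W`. -/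
structure IsLinearlyGeneral (n : ℕ) (V : Submodule K A) : Prop where
  one_mem : 1 ∈ V
  finrank_eq : finrank K V = n + 1
  finrank_quotient_add_le : ∀ W ≤ V, W ≠ ⊥ →
    finrank K (A ⧸ Ideal.span (W : Set A)) + finrank K W ≤ n + 1

namespace IsLinearlyGeneral

variable [Module.Finite K A] {n : ℕ} {V : Submodule K A}

theorem finrank_add_finrank_le (hV : IsLinearlyGeneral n V) {W : Submodule K A} (hW : W ≤ V)
    (hW0 : W ≠ ⊥) {J : Ideal A} (hWJ : (W : Set A) ⊆ J) :
    finrank K A + finrank K W ≤ n + 1 + finrank K (J.restrictScalars K) := by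
  have hquot := hV.finrank_quotient_add_le W hW hW0
  have hspan := finrank_quotient_add_finrank_restrictScalars (K := K) (Ideal.span (W : Set A))
  have hle : (Ideal.span (W : Set A)).restrictScalars K ≤ J.restrictScalars K :=
    Ideal.span_le.mpr hWJ
  have hmono := Submodule.finrank_mono hle
  omega

theorem sup_eq_top (hV : IsLinearlyGeneral n V) {J : Ideal A}
    (hJ : finrank K A ≤ finrank K (J.restrictScalars K) + n + 1) :
    V ⊔ J.restrictScalars K = ⊤ := by
  apply Submodule.eq_top_of_finrank_eq
  have hdim := Submodule.finrank_sup_add_finrank_inf_eq V (J.restrictScalars K)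
  rw [hV.finrank_eq] at hdim
  have hle := Submodule.finrank_le (V ⊔ J.restrictScalars K)
  by_cases hinf : V ⊓ J.restrictScalars K = ⊥
  · rw [hinf, finrank_bot] at hdim
    omega
  · have hlgp := hV.finrank_add_finrank_le inf_le_left hinf fun x hx => hx.2
    omega

theorem finrank_inf (hV : IsLinearlyGeneral n V) {J : Ideal A} {c : ℕ} (hc : c ≤ n)
    (hJ : finrank K A = finrank K (J.restrictScalars K) + c) :
    finrank K (V ⊓ J.restrictScalars K : Submodule K A) + c = n + 1 := by
  have hdim := Submodule.finrank_sup_add_finrank_inf_eq V (J.restrictScalars K)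
  rw [hV.finrank_eq, hV.sup_eq_top (by omega), finrank_top] at hdim
  omega

theorem span_inf (hV : IsLinearlyGeneral n V) {J : Ideal A} {c : ℕ} (hc : c ≤ n)
    (hJ : finrank K A = finrank K (J.restrictScalars K) + c) :
    Ideal.span ((V ⊓ J.restrictScalars K : Submodule K A) : Set A) = J := by
  have hdim := hV.finrank_inf hc hJ
  have hne : V ⊓ J.restrictScalars K ≠ ⊥ := by
    intro hbot
    rw [hbot, finrank_bot] at hdim
    omega
  have hlgp := hV.finrank_add_finrank_le inf_le_left hne Ideal.subset_span
  exact Submodule.restrictScalars_injective K A A (Submodule.eq_of_le_of_finrank_le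
    (Ideal.span_le.mpr fun x hx => hx.2) (by omega))

theorem finrank_ker_mulLeft_le (hV : IsLinearlyGeneral n V) {v : A} (hv : v ∈ V) (hv0 : v ≠ 0) :
    finrank K (LinearMap.ker (LinearMap.mulLeft K v)) ≤ n := by
  have hlgp := hV.finrank_add_finrank_le (W := K ∙ v) (J := Ideal.span {v}) (by simpa using hv)
    (by simpa using hv0) (Submodule.span_subset_span K A {v})
  have hspan := finrank_span_singleton_add_finrank_ker_mulLeft (K := K) v
  rw [finrank_span_singleton hv0] at hlgp
  omega

theorem mul_ne_zero (hV : IsLinearlyGeneral n V) (hA : 2 * n < finrank K A) {v w : A} (hv : v ∈ V)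
    (hw : w ∈ V) (hv0 : v ≠ 0) (hw0 : w ≠ 0) : v * w ≠ 0 := by
  intro hvw
  have hkerv := hV.finrank_ker_mulLeft_le hv hv0
  have hkerw := hV.finrank_ker_mulLeft_le hw hw0
  have hle : LinearMap.range (LinearMap.mulLeft K w) ≤ LinearMap.ker (LinearMap.mulLeft K v) := by
    rintro _ ⟨a, rfl⟩
    simp [← mul_assoc, hvw]
  have hmono := Submodule.finrank_mono hle
  have hdim := LinearMap.finrank_range_add_finrank_ker (LinearMap.mulLeft K w)
  omega

theorem exists_span_singleton_eq (hV : IsLinearlyGeneral n V) {J : Ideal A}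
    (hJ : finrank K A = finrank K (J.restrictScalars K) + n) :
    ∃ v ∈ V, Ideal.span {v} = J := by
  have hdim := hV.finrank_inf le_rfl hJ
  obtain ⟨⟨v, hv⟩, -, hvspan⟩ := finrank_eq_one_iff'.mp
    (show finrank K (V ⊓ J.restrictScalars K : Submodule K A) = 1 by omega)
  refine ⟨v, hv.1, le_antisymm ((Ideal.span_singleton_le_iff_mem J).mpr hv.2) ?_⟩
  rw [← hV.span_inf le_rfl hJ]
  refine Ideal.span_le.mpr fun x hx => ?_
  obtain ⟨c, hc⟩ := hvspan ⟨x, hx⟩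
  rw [← show c • v = x from congrArg Subtype.val hc]
  exact Submodule.smul_of_tower_mem _ c (Ideal.mem_span_singleton_self v)

/-- Castelnuovo's bound. The induction on `k` passes from `I` to its residual ideal with respect to
a hyperplane that cuts `Spec A` in a subscheme of length `n` contained in `Spec (A / I)`. -/
theorem min_le_finrank_pow_sup [IsAlgClosed K] (hV : IsLinearlyGeneral n V) (k : ℕ)
    (I : Ideal A) :
    min (finrank K A) (finrank K (I.restrictScalars K) + n * k + 1) ≤
      finrank K (V ^ k ⊔ I.restrictScalars K : Submodule K A) := by
  induction k generalizing I with
  | zero =>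
    by_cases hI : I = ⊤
    · rw [hI, Submodule.restrictScalars_top, sup_top_eq, finrank_top]
      exact min_le_left _ _
    · have hlt : I.restrictScalars K < V ^ 0 ⊔ I.restrictScalars K := by
        refine right_lt_sup.mpr fun hle => hI ((Ideal.eq_top_iff_one _).mpr (hle ?_))
        exact Submodule.one_le.mp (pow_zero V).ge
      have hrank := Submodule.finrank_lt_finrank_of_lt hlt
      omega
  | succ k ih =>
    have hVk : V ≤ V ^ (k + 1) := le_self_pow (Submodule.one_le.mpr hV.one_mem) (by omega)
    by_cases hI : finrank K A ≤ finrank K (I.restrictScalars K) + n + 1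
    · rw [eq_top_mono (sup_le_sup_right hVk _) (hV.sup_eq_top hI), finrank_top]
      exact min_le_left _ _
    · obtain ⟨J, hIJ, hJ⟩ := exists_ideal_finrank_eq (K := K) I
        (m := finrank K A - n) (by omega) (by omega)
      obtain ⟨v, hv, rfl⟩ := hV.exists_span_singleton_eq (J := J) (by omega)
      have htop : V ^ (k + 1) ⊔ I.restrictScalars K ⊔ (Ideal.span {v}).restrictScalars K = ⊤ :=
        eq_top_mono (sup_le_sup_right (hVk.trans le_sup_left) _) (hV.sup_eq_top (by omega))
      have hle := finrank_pow_sup_colon_add_le hv hIJ k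
      rw [htop, finrank_top] at hle
      have hcolon := finrank_colon_add (K := K) hIJ
      have hind := ih (I.colon {v})
      rw [Nat.mul_succ]
      omega

theorem min_le_finrank_map_pow [IsAlgClosed K] (hV : IsLinearlyGeneral n V) {B : Type*}
    [CommRing B] [Algebra K B] {ψ : A →ₐ[K] B} (hψ : Function.Surjective ψ) (k : ℕ) :
    min (finrank K B) (n * k + 1) ≤ finrank K ((V ^ k).map ψ.toLinearMap) := by
  have hdim := LinearMap.finrank_range_add_finrank_ker ψ.toLinearMap
  rw [LinearMap.range_eq_top.mpr hψ, finrank_top] at hdim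
  have hmap := finrank_map_add_finrank_inf_ker ψ.toLinearMap (V ^ k)
  have hbound : min (finrank K A) (finrank K (LinearMap.ker ψ.toLinearMap) + n * k + 1) ≤
      finrank K (V ^ k ⊔ LinearMap.ker ψ.toLinearMap : Submodule K A) :=
    hV.min_le_finrank_pow_sup k (RingHom.ker ψ)
  have hsup := Submodule.finrank_sup_add_finrank_inf_eq (V ^ k) (LinearMap.ker ψ.toLinearMap)
  omega

end IsLinearlyGeneral

end LinearlyGeneralPosition

section Pencil

variable {K M : Type*} [Field K] [AddCommGroup M] [Module K M] {N : Submodule K (M × M)}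

theorem finrank_le_finrank_map_fst_add_one [Module.Finite K M] {V : Submodule K M}
    (hNV : N ≤ V.prod V) (hN : finrank K V ≤ finrank K N + 1) (hfst : ∀ g, (0, g) ∈ N → g = 0)
    {H : Submodule K M} (hH : H ≤ V) :
    finrank K H ≤
      finrank K ((N ⊓ H.comap (LinearMap.snd K M M)).map (LinearMap.fst K M M)) + 1 := by
  have hdim := Submodule.finrank_sup_add_finrank_inf_eq N (V.prod H)
  have hsup := Submodule.finrank_mono (sup_le hNV (Submodule.prod_mono le_rfl hH))
  have hinf := Submodule.finrank_mono
    (show N ⊓ V.prod H ≤ N ⊓ H.comap (LinearMap.snd K M M) from fun x hx => ⟨hx.1, hx.2.2⟩)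
  have hmap := finrank_map_add_finrank_inf_ker (LinearMap.fst K M M)
    (N ⊓ H.comap (LinearMap.snd K M M))
  have hker : N ⊓ H.comap (LinearMap.snd K M M) ⊓ LinearMap.ker (LinearMap.fst K M M) = ⊥ := by
    rw [eq_bot_iff]
    rintro ⟨f, g⟩ ⟨hfg, hf⟩
    obtain rfl : f = 0 := hf
    simp [hfst g hfg.1]
  rw [hker, finrank_bot] at hmap
  rw [finrank_submodule_prod] at hdim hsup
  omega

theorem exists_chain [Module.Finite K M] {V : Submodule K M} (hNV : N ≤ V.prod V)
    (hN : finrank K V ≤ finrank K N + 1) (hfst : ∀ g, (0, g) ∈ N → g = 0) (k : ℕ) :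
    ∃ H : Submodule K M, H ≤ V ∧ finrank K V ≤ finrank K H + k ∧
      ∀ v ∈ H, ∃ u : ℕ → M, u 0 = v ∧ ∀ i < k, (u i, u (i + 1)) ∈ N := by
  induction k with
  | zero => exact ⟨V, le_rfl, le_rfl, fun v _ => ⟨fun _ => v, rfl, by simp⟩⟩
  | succ k ih =>
    obtain ⟨H, hHV, hH, hu⟩ := ih
    have hstep := finrank_le_finrank_map_fst_add_one hNV hN hfst hHV
    refine ⟨(N ⊓ H.comap (LinearMap.snd K M M)).map (LinearMap.fst K M M), ?_, by omega, ?_⟩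
    · rintro _ ⟨x, hx, rfl⟩
      exact (hNV hx.1).1
    · rintro _ ⟨⟨v, w⟩, hvw, rfl⟩
      obtain ⟨u, rfl, hu⟩ := hu w hvw.2
      refine ⟨fun i => Nat.casesOn i v u, rfl, fun i hi => ?_⟩
      cases i with
      | zero => exact hvw.1
      | succ i => exact hu i (by omega)

/-- The linear map `K[X] → M` that sends `X ^ i` to the `i`-th term of the sequence `u`. If `N`
contains the pairs of consecutive terms, it contains the pairs of values at `p` and `X * p`. -/
def sequenceMap (K : Type*) {M : Type*} [Field K] [AddCommGroup M] [Module K M] (u : ℕ → M) :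
    Polynomial K →ₗ[K] M :=
  Polynomial.lsum fun i => LinearMap.toSpanSingleton K M (u i)

theorem sequenceMap_monomial (u : ℕ → M) (i : ℕ) (c : K) :
    sequenceMap K u (Polynomial.monomial i c) = c • u i := by
  simp [sequenceMap, Polynomial.lsum_apply, Polynomial.sum_monomial_index]

theorem sequenceMap_pair_mem {u : ℕ → M} {n : ℕ} (hu : ∀ i < n, (u i, u (i + 1)) ∈ N)
    {p : Polynomial K} (hp : p.natDegree < n) :
    (sequenceMap K u p, sequenceMap K u (Polynomial.X * p)) ∈ N := by
  change (sequenceMap K u).prod (sequenceMap K u ∘ₗ LinearMap.mulLeft K Polynomial.X) p ∈ N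
  rw [p.as_sum_range' n hp, map_sum]
  refine Submodule.sum_mem _ fun i hi => ?_
  rw [LinearMap.prod_apply, Function.prod_apply, LinearMap.comp_apply, LinearMap.mulLeft_apply,
    Polynomial.X_mul_monomial, sequenceMap_monomial, sequenceMap_monomial]
  exact N.smul_mem _ (hu i (Finset.mem_range.mp hi))

theorem eq_zero_of_sequenceMap_eq_zero [IsAlgClosed K] {u : ℕ → M} {n : ℕ}
    (hu : ∀ i < n, (u i, u (i + 1)) ∈ N) (hu0 : u 0 ≠ 0)
    (heig : ∀ (f : M) (c : K), (f, c • f) ∈ N → f = 0) {p : Polynomial K} (hp : p.natDegree ≤ n)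
    (hup : sequenceMap K u p = 0) : p = 0 := by
  induction hm : p.natDegree generalizing p with
  | zero =>
    rw [Polynomial.eq_C_of_natDegree_eq_zero hm, ← Polynomial.monomial_zero_left,
      sequenceMap_monomial] at hup
    rw [Polynomial.eq_C_of_natDegree_eq_zero hm, (smul_eq_zero.mp hup).resolve_right hu0, map_zero]
  | succ m ih =>
    obtain ⟨c, hc⟩ := IsAlgClosed.exists_root p
      (Polynomial.natDegree_pos_iff_degree_pos.mp (by omega)).ne'
    obtain ⟨p', rfl⟩ := Polynomial.dvd_iff_isRoot.mpr hc
    have hp' : p' ≠ 0 := by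
      rintro rfl
      simp at hm
    rw [Polynomial.natDegree_mul (Polynomial.X_sub_C_ne_zero c) hp',
      Polynomial.natDegree_X_sub_C] at hm hp
    have hpair := sequenceMap_pair_mem hu (p := p') (by omega)
    rw [sub_mul, map_sub, sub_eq_zero, ← Polynomial.smul_eq_C_mul, map_smul] at hup
    rw [hup] at hpair
    exact absurd (ih (by omega) (heig _ _ hpair) (by omega)) hp'

theorem linearIndependent_of_chain [IsAlgClosed K] {u : ℕ → M} {n : ℕ}
    (hu : ∀ i < n, (u i, u (i + 1)) ∈ N) (hu0 : u 0 ≠ 0)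
    (heig : ∀ (f : M) (c : K), (f, c • f) ∈ N → f = 0) :
    LinearIndependent K fun i : Fin (n + 1) => u i := by
  rw [Fintype.linearIndependent_iff]
  intro g hg i
  have hzero : ∑ i : Fin (n + 1), Polynomial.monomial (i : ℕ) (g i) = 0 :=
    eq_zero_of_sequenceMap_eq_zero hu hu0 heig
      (Polynomial.natDegree_sum_le_of_forall_le _ _ fun i _ =>
        (Polynomial.natDegree_monomial_le _).trans (by omega))
      (by simpa only [map_sum, sequenceMap_monomial] using hg)
  simpa [Polynomial.finsetSum_coeff, Polynomial.coeff_monomial, Fin.val_inj] using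
    congrArg (Polynomial.coeff · (i : ℕ)) hzero

/-- Kronecker's normal form of a pencil without eigenvectors. -/
theorem exists_linearIndependent_chain [IsAlgClosed K] [Module.Finite K M] {n : ℕ}
    {V : Submodule K M} (hV : finrank K V = n + 1) (hNV : N ≤ V.prod V) (hN : n ≤ finrank K N)
    (hfst : ∀ g, (0, g) ∈ N → g = 0) (heig : ∀ (f : M) (c : K), (f, c • f) ∈ N → f = 0) :
    ∃ u : ℕ → M, (∀ i < n, (u i, u (i + 1)) ∈ N) ∧
      LinearIndependent K fun i : Fin (n + 1) => u i := by
  obtain ⟨H, -, hH, hu⟩ := exists_chain hNV (by omega) hfst n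
  have hH0 : H ≠ ⊥ := by
    rintro rfl
    rw [finrank_bot] at hH
    omega
  obtain ⟨v, hv, hv0⟩ := Submodule.exists_mem_ne_zero_of_ne_bot hH0
  obtain ⟨u, rfl, hu⟩ := hu v hv
  exact ⟨u, hu, linearIndependent_of_chain hu hv0 heig⟩

end Pencil

section DualizingFunctional

variable {K A : Type*} [Field K] [CommRing A] [Algebra K A]

/-- The largest ideal contained in the kernel of the functional `φ`. The pairing induced by
`(x, y) ↦ φ (x * y)` on the quotient by it is perfect, so the subscheme that it defines is
Gorenstein with dualizing functional `φ`. -/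
def kerIdeal (φ : A →ₗ[K] K) : Ideal A where
  carrier := {x | ∀ a, φ (x * a) = 0}
  add_mem' {x y} hx hy a := by rw [add_mul, map_add, hx, hy, add_zero]
  zero_mem' a := by rw [zero_mul, map_zero]
  smul_mem' b x hx a := by
    rw [smul_eq_mul, mul_comm b x, mul_assoc]
    exact hx _

variable {φ : A →ₗ[K] K}

theorem kerIdeal_ne_top (hφ : φ ≠ 0) : kerIdeal φ ≠ ⊤ := by
  intro htop
  refine hφ (LinearMap.ext fun a => ?_)
  have hone : (1 : A) ∈ kerIdeal φ := htop ▸ trivial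
  simpa using hone a

theorem le_kerIdeal {I : Ideal A} (hI : I.restrictScalars K ≤ LinearMap.ker φ) : I ≤ kerIdeal φ :=
  fun _ hx a => hI (I.mul_mem_right a hx)

theorem sup_kerIdeal_mul_le_ker {X Y : Submodule K A} (hXY : X * Y ≤ LinearMap.ker φ) :
    (X ⊔ (kerIdeal φ).restrictScalars K) * (Y ⊔ (kerIdeal φ).restrictScalars K) ≤
      LinearMap.ker φ := by
  rw [Submodule.sup_mul, Submodule.mul_sup]
  refine sup_le (sup_le hXY ?_) ?_ <;> rw [Submodule.mul_le]
  · intro x _ i hi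
    rw [mul_comm]
    exact hi x
  · exact fun i hi y _ => hi y

variable [Module.Finite K A]

theorem finrank_add_finrank_le_of_mul_le_ker {X Y : Submodule K A}
    (hXY : X * Y ≤ LinearMap.ker φ) :
    finrank K X + finrank K Y ≤ finrank K A + finrank K ((kerIdeal φ).restrictScalars K) := by
  let B : LinearMap.BilinForm K A := (LinearMap.mul K A).compr₂ φ
  have hB : B.IsSymm := ⟨fun x y => congrArg φ (mul_comm x y)⟩
  have hdim := LinearMap.BilinForm.finrank_add_finrank_orthogonal hB.isRefl X
  have hY := Submodule.finrank_mono
    (show Y ≤ B.orthogonal X from fun y hy x hx => hXY (Submodule.mul_mem_mul hx hy))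
  have hX := Submodule.finrank_mono
    (show X ⊓ B.orthogonal ⊤ ≤ (kerIdeal φ).restrictScalars K from
      fun x hx a => (congrArg φ (mul_comm x a)).trans (hx.2 a trivial))
  omega

namespace IsLinearlyGeneral

variable [IsAlgClosed K] {n q : ℕ} {V : Submodule K A}

theorem finrank_kerIdeal_add_le (hV : IsLinearlyGeneral n V) (hq : 1 ≤ q) (hφ : φ ≠ 0)
    (hφV : V ^ q ≤ LinearMap.ker φ) :
    finrank K ((kerIdeal φ).restrictScalars K) + n * q + 2 ≤ finrank K A := by
  obtain ⟨p, rfl⟩ := Nat.exists_eq_add_of_le' hq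
  have hlt : finrank K ((kerIdeal φ).restrictScalars K) < finrank K A :=
    Submodule.finrank_lt (by simpa using kerIdeal_ne_top hφ)
  have hpair := finrank_add_finrank_le_of_mul_le_ker
    (sup_kerIdeal_mul_le_ker (X := V ^ p) (Y := V ^ 1) (by rwa [← pow_add]))
  have hp := hV.min_le_finrank_pow_sup p (kerIdeal φ)
  have hone := hV.min_le_finrank_pow_sup 1 (kerIdeal φ)
  rw [Nat.mul_succ]
  omega

theorem finrank_sq_sup_kerIdeal_le (hV : IsLinearlyGeneral n V) (hq : 2 ≤ q)
    (hφV : V ^ q ≤ LinearMap.ker φ)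
    (hA : finrank K A = finrank K ((kerIdeal φ).restrictScalars K) + n * q + 2) :
    finrank K (V ^ 2 ⊔ (kerIdeal φ).restrictScalars K : Submodule K A) ≤
      finrank K ((kerIdeal φ).restrictScalars K) + 2 * n + 1 := by
  obtain ⟨p, rfl⟩ := Nat.exists_eq_add_of_le' hq
  have hpair := finrank_add_finrank_le_of_mul_le_ker
    (sup_kerIdeal_mul_le_ker (X := V ^ p) (Y := V ^ 2) (by rwa [← pow_add]))
  have hp := hV.min_le_finrank_pow_sup p (kerIdeal φ)
  rw [Nat.mul_add] at hA
  omega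

theorem exists_functional (hV : IsLinearlyGeneral n V) (hq : 2 ≤ q)
    (hVq : finrank K (V ^ q : Submodule K A) = n * q + 1) (hA : n * q + 2 ≤ finrank K A) :
    ∃ φ : A →ₗ[K] K, V ^ q ≤ LinearMap.ker φ ∧
      V ^ q ⊓ (kerIdeal φ).restrictScalars K = ⊥ ∧
      finrank K (V ^ 2 : Submodule K A) ≤ 2 * n + 1 := by
  obtain ⟨I, hI⟩ := exists_ideal_finrank_eq_of_le (K := K) (A := A)
    (m := finrank K A - (n * q + 2)) (by omega)
  have hbound := hV.min_le_finrank_pow_sup q I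
  have hdim := Submodule.finrank_sup_add_finrank_inf_eq (V ^ q) (I.restrictScalars K)
  have hinf : V ^ q ⊓ I.restrictScalars K = ⊥ := by
    rw [← Submodule.finrank_eq_zero (R := K)]
    omega
  have hlt : V ^ q ⊔ I.restrictScalars K < ⊤ := by
    refine lt_top_iff_ne_top.mpr fun htop => ?_
    rw [htop, finrank_top] at hdim
    omega
  obtain ⟨φ, hφ, hφker⟩ := Submodule.exists_le_ker_of_lt_top _ hlt
  have hφV : V ^ q ≤ LinearMap.ker φ := le_sup_left.trans hφker
  have hle : I.restrictScalars K ≤ (kerIdeal φ).restrictScalars K :=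
    le_kerIdeal (le_sup_right.trans hφker)
  have hker := hV.finrank_kerIdeal_add_le (by omega) hφ hφV
  obtain rfl : I = kerIdeal φ := Submodule.restrictScalars_injective K A A
    (Submodule.eq_of_le_of_finrank_le hle (by omega))
  have hsq := hV.finrank_sq_sup_kerIdeal_le hq hφV (by omega)
  have hsqdim := Submodule.finrank_sup_add_finrank_inf_eq (V ^ 2) ((kerIdeal φ).restrictScalars K)
  have hsqinf : V ^ 2 ⊓ (kerIdeal φ).restrictScalars K = ⊥ :=
    eq_bot_mono (inf_le_inf_right _ (pow_le_pow_right' (Submodule.one_le.mpr hV.one_mem) hq)) hinf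
  rw [hsqinf, finrank_bot] at hsqdim
  exact ⟨φ, hφV, hinf, by omega⟩

end IsLinearlyGeneral

end DualizingFunctional

section Castelnuovo

variable {K A : Type*} [Field K] [CommRing A] [Algebra K A]

/-- The pairs `(f, g)` in `V` with `f / g = s / t`. When `s` and `t` span the linear forms through
`n - 1` general points of a rational normal curve, these are the pairs of forms that the projection
of the curve to `ℙ¹` identifies with `(s, t)`. -/
def pencil (V : Submodule K A) (s t : A) : Submodule K (A × A) :=
  V.prod V ⊓ LinearMap.ker (LinearMap.mulLeft K s ∘ₗ LinearMap.snd K A A -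
    LinearMap.mulLeft K t ∘ₗ LinearMap.fst K A A)

variable {V : Submodule K A} {s t : A}

theorem mem_pencil {f g : A} : (f, g) ∈ pencil V s t ↔ (f ∈ V ∧ g ∈ V) ∧ s * g = t * f :=
  and_congr Iff.rfl sub_eq_zero

theorem mul_eq_mul_of_mem_pencil {φ : A →ₗ[K] K} (hφ : V ^ 3 ≤ LinearMap.ker φ)
    (hinf : V ^ 2 ⊓ (kerIdeal φ).restrictScalars K = ⊥)
    (hst : V ⊔ (Ideal.span {s, t}).restrictScalars K = ⊤) {f g f' g' : A}
    (hfg : (f, g) ∈ pencil V s t) (hfg' : (f', g') ∈ pencil V s t) : f * g' = g * f' := by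
  obtain ⟨⟨hf, hg⟩, hfg⟩ := mem_pencil.mp hfg
  obtain ⟨⟨hf', hg'⟩, hfg'⟩ := mem_pencil.mp hfg'
  have hsq : f * g' - g * f' ∈ V ^ 2 := by
    rw [pow_two]
    exact Submodule.sub_mem _ (Submodule.mul_mem_mul hf hg') (Submodule.mul_mem_mul hg hf')
  have hspan : ∀ j ∈ Ideal.span {s, t}, (f * g' - g * f') * j = 0 := by
    intro j hj
    obtain ⟨a, b, rfl⟩ := Ideal.mem_span_pair.mp hj
    linear_combination (a * f + b * g) * hfg' - (a * f' + b * g') * hfg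
  have hker : f * g' - g * f' ∈ kerIdeal φ := by
    intro a
    obtain ⟨w, hw, j, hj, rfl⟩ := Submodule.mem_sup.mp (hst.symm ▸ Submodule.mem_top (x := a))
    rw [mul_add, hspan j hj, add_zero]
    exact hφ (pow_succ V 2 ▸ Submodule.mul_mem_mul hsq hw)
  exact sub_eq_zero.mp ((Submodule.mem_bot K).mp (hinf ▸ ⟨hsq, hker⟩))

variable [Module.Finite K A] {n : ℕ}

theorem le_finrank_pencil (hV1 : 1 ∈ V) (hV : n + 1 ≤ finrank K V)
    (hV2 : finrank K (V ^ 2 : Submodule K A) ≤ 2 * n + 1) (hs : s ∈ V) (ht : t ∈ V)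
    (hst : V ⊔ (Ideal.span {s, t}).restrictScalars K = ⊤)
    (hcodim : finrank K ((Ideal.span {s, t}).restrictScalars K) + n ≤ finrank K A + 1) :
    n ≤ finrank K (pencil V s t) := by
  set J := Ideal.span {s, t}
  have hdim := finrank_map_add_finrank_inf_ker (LinearMap.mulLeft K s ∘ₗ LinearMap.snd K A A -
    LinearMap.mulLeft K t ∘ₗ LinearMap.fst K A A) (V.prod V)
  rw [finrank_submodule_prod] at hdim
  have hle : (V.prod V).map (LinearMap.mulLeft K s ∘ₗ LinearMap.snd K A A -
      LinearMap.mulLeft K t ∘ₗ LinearMap.fst K A A) ≤ V ^ 2 ⊓ J.restrictScalars K := by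
    rintro _ ⟨⟨f, g⟩, ⟨hf, hg⟩, rfl⟩
    rw [pow_two]
    exact ⟨Submodule.sub_mem _ (Submodule.mul_mem_mul hs hg) (Submodule.mul_mem_mul ht hf),
      J.sub_mem (J.mul_mem_right _ (Ideal.subset_span (by simp)))
        (J.mul_mem_right _ (Ideal.subset_span (by simp)))⟩
  have hmono := Submodule.finrank_mono hle
  have hsum := Submodule.finrank_sup_add_finrank_inf_eq (V ^ 2) (J.restrictScalars K)
  rw [eq_top_mono (sup_le_sup_right (le_self_pow (Submodule.one_le.mpr hV1) two_ne_zero) _) hst,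
    finrank_top] at hsum
  change n ≤ finrank K (V.prod V ⊓ LinearMap.ker _ : Submodule K (A × A))
  omega

namespace IsLinearlyGeneral

theorem exists_span_pair (hV : IsLinearlyGeneral n V) {J : Ideal A} (hn : 1 ≤ n)
    (hJ : finrank K A + 1 = finrank K (J.restrictScalars K) + n) :
    ∃ s ∈ V, ∃ t ∈ V, LinearIndependent K ![s, t] ∧ Ideal.span {s, t} = J := by
  have hcodim : finrank K A = finrank K (J.restrictScalars K) + (n - 1) := by omega
  have hdim := hV.finrank_inf (by omega) hcodim
  let b : Basis (Fin 2) K (V ⊓ J.restrictScalars K : Submodule K A) :=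
    finBasisOfFinrankEq K _ (by omega)
  refine ⟨b 0, (b 0).2.1, b 1, (b 1).2.1, ?_, ?_⟩
  · have hli := b.linearIndependent.map' (Submodule.subtype _) (Submodule.ker_subtype _)
    rwa [show Submodule.subtype _ ∘ b = ![(b 0 : A), (b 1 : A)] by
      ext i; fin_cases i <;> rfl] at hli
  · refine le_antisymm (Ideal.span_le.mpr ?_) ?_
    · rintro _ (rfl | rfl)
      exacts [(b 0).2.2, (b 1).2.2]
    · refine (hV.span_inf (by omega) hcodim).ge.trans (Ideal.span_le.mpr fun x hx => ?_)
      have hrepr := congrArg Subtype.val (b.sum_repr ⟨x, hx⟩)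
      rw [Fin.sum_univ_two] at hrepr
      rw [← show _ = x from hrepr]
      exact Ideal.add_mem _ (Submodule.smul_of_tower_mem _ _ (Ideal.subset_span (by simp)))
        (Submodule.smul_of_tower_mem _ _ (Ideal.subset_span (by simp)))

theorem eq_zero_of_smul_mem_pencil (hV : IsLinearlyGeneral n V) (hA : 2 * n < finrank K A)
    (hs : s ∈ V) (ht : t ∈ V) (hst : LinearIndependent K ![s, t]) {f : A} {c : K}
    (hf : (f, c • f) ∈ pencil V s t) : f = 0 := by
  obtain ⟨⟨hfV, -⟩, hf⟩ := mem_pencil.mp hf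
  by_contra hf0
  refine hV.mul_ne_zero hA (V.sub_mem (V.smul_mem c hs) ht) hfV ?_ hf0 ?_
  · intro h
    have hcoef := LinearIndependent.pair_iff.mp hst c (-1) (by rw [← h]; module)
    exact neg_ne_zero.mpr one_ne_zero hcoef.2
  · rw [sub_mul, ← hf, mul_smul_comm, smul_mul_assoc, sub_self]

/-- Castelnuovo's lemma: a scheme of degree at least `n * q + 2` in linearly general position that
imposes only `n * q + 1` conditions in degree `q` satisfies the equations of a rational normal
curve, the minors of the matrix with rows `u 0, …, u (n - 1)` and `u 1, …, u n`. -/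
theorem exists_minors_eq_zero [IsAlgClosed K] {q : ℕ} (hV : IsLinearlyGeneral n V) (hn : 1 ≤ n)
    (hq : 3 ≤ q) (hVq : finrank K (V ^ q : Submodule K A) = n * q + 1)
    (hA : n * q + 2 ≤ finrank K A) :
    ∃ u : ℕ → A, (∀ i ≤ n, u i ∈ V) ∧ (LinearIndependent K fun i : Fin (n + 1) => u i) ∧
      ∀ i < n, ∀ j < n, u i * u (j + 1) = u (i + 1) * u j := by
  have hnq : n * 3 ≤ n * q := Nat.mul_le_mul_left n hq
  have hpow : ∀ {k}, k ≤ q → V ^ k ≤ V ^ q := pow_le_pow_right' (Submodule.one_le.mpr hV.one_mem)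
  obtain ⟨φ, hφV, hinf, hV2⟩ := hV.exists_functional (by omega) hVq hA
  have hinf2 : V ^ 2 ⊓ (kerIdeal φ).restrictScalars K = ⊥ :=
    eq_bot_mono (inf_le_inf_right _ (hpow (by omega))) hinf
  obtain ⟨J, hJ⟩ := exists_ideal_finrank_eq_of_le (K := K) (A := A)
    (m := finrank K A - (n - 1)) (by omega)
  obtain ⟨s, hs, t, ht, hst, rfl⟩ := hV.exists_span_pair (J := J) hn (by omega)
  have htop := hV.sup_eq_top (J := Ideal.span {s, t}) (by omega)
  obtain ⟨u, hu, hli⟩ := exists_linearIndependent_chain hV.finrank_eq (N := pencil V s t)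
    inf_le_left (le_finrank_pencil hV.one_mem hV.finrank_eq.ge hV2 hs ht htop (by omega))
    (fun g hg => by
      obtain ⟨⟨-, hgV⟩, hsg⟩ := mem_pencil.mp hg
      by_contra hg0
      exact hV.mul_ne_zero (by omega) hs hgV (hst.ne_zero 0) hg0 (by simpa using hsg))
    (fun f c => hV.eq_zero_of_smul_mem_pencil (by omega) hs ht hst)
  refine ⟨u, fun i hi => ?_, hli, fun i hi j hj =>
    mul_eq_mul_of_mem_pencil ((hpow hq).trans hφV) hinf2 htop (hu i hi) (hu j hj)⟩
  rcases hi.lt_or_eq with hlt | rfl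
  · exact (mem_pencil.mp (hu i hlt)).1.1
  · obtain ⟨m, rfl⟩ := Nat.exists_eq_add_of_le' hn
    exact (mem_pencil.mp (hu m (by omega))).1.2

end IsLinearlyGeneral

end Castelnuovo

section Homogeneous

variable {K : Type*} [Field K] {σ : Type*}

theorem aeval_mul_of_isHomogeneous {A : Type*} [CommRing A] [Algebra K A] {f : MvPolynomial σ K}
    {k : ℕ} (hf : f.IsHomogeneous k) (c : A) (x : σ → A) :
    aeval (fun i => c * x i) f = c ^ k * aeval x f := by
  rw [aeval_def, aeval_def, eval₂_eq, eval₂_eq, Finset.mul_sum]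
  refine Finset.sum_congr rfl fun d hd => ?_
  have hdk : ∑ i ∈ d.support, d i = k := by
    rw [← Finsupp.degree_apply]
    by_contra h
    exact mem_support_iff.mp hd (hf.coeff_eq_zero h)
  simp only [mul_pow, Finset.prod_mul_distrib, Finset.prod_pow_eq_pow_sum, hdk]
  ring

theorem eval_smul_of_isHomogeneous {f : MvPolynomial σ K} {k : ℕ} (hf : f.IsHomogeneous k) (c : K)
    (x : σ → K) : eval (c • x) f = c ^ k * eval x f := by
  simp only [← coe_aeval_eq_eval]
  exact aeval_mul_of_isHomogeneous hf c x

theorem homogeneousComponent_mul_of_isHomogeneous {f : MvPolynomial σ K} {m : ℕ}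
    (hf : f.IsHomogeneous m) (g : MvPolynomial σ K) (k : ℕ) :
    homogeneousComponent (k + m) (g * f) = homogeneousComponent k g * f := by
  conv_lhs => rw [← sum_homogeneousComponent g, Finset.sum_mul, map_sum]
  have component_mul : ∀ i, homogeneousComponent (k + m) (homogeneousComponent i g * f) =
      if i = k then homogeneousComponent k g * f else 0 := by
    intro i
    rw [homogeneousComponent_of_mem ((homogeneousComponent_isHomogeneous i g).mul hf)]
    by_cases hik : i = k
    · simp [hik]
    · rw [if_neg (by omega), if_neg hik]
  simp only [component_mul, Finset.sum_ite_eq', Finset.mem_range]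
  split_ifs with hk
  · rfl
  · rw [homogeneousComponent_eq_zero _ _ (by omega), zero_mul]

theorem isHomogeneous_of_mul {f g : MvPolynomial σ K} {k m : ℕ} (hf : f.IsHomogeneous m)
    (hf0 : f ≠ 0) (hgf : (g * f).IsHomogeneous (k + m)) : g.IsHomogeneous k := by
  have hcomp := homogeneousComponent_mul_of_isHomogeneous hf g k
  rw [homogeneousComponent_eq_self hgf] at hcomp
  rw [mul_right_cancel₀ hf0 hcomp]
  exact homogeneousComponent_isHomogeneous k g

theorem isHomogeneous_of_mul_X_pow {g : MvPolynomial σ K} {k m : ℕ} {i : σ}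
    (hg : (g * X i ^ m).IsHomogeneous (k + m)) : g.IsHomogeneous k :=
  isHomogeneous_of_mul (isHomogeneous_X_pow i m) (pow_ne_zero _ (X_ne_zero _)) hg

end Homogeneous

section Sections

variable {K : Type*} [Field K] {n : ℕ}

/-- The inclusion of the coordinate ring into its field of fractions. -/
abbrev toFrac (K : Type*) [Field K] (n : ℕ) : CoordRing K n →ₐ[K] Frac K n :=
  IsScalarTower.toAlgHom K (CoordRing K n) (Frac K n)

theorem toFrac_injective : Function.Injective (toFrac K n) :=
  IsFractionRing.injective (CoordRing K n) (Frac K n)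

theorem toFrac_X_ne_zero (i : Fin (n + 1)) : toFrac K n (X i) ≠ 0 := by
  rw [Ne, map_eq_zero_iff _ toFrac_injective]
  exact X_ne_zero i

theorem monomial_overlap (i j : Fin (n + 1)) :
    (monomial (overlap i j) 1 : CoordRing K n) = X i * X j := by
  simp [overlap, chart, X, monomial_mul]

theorem mem_sections {J : Ideal (CoordRing K n)} {q : ℕ} {a : Fin (n + 1) →₀ ℕ} {z : Frac K n} :
    z ∈ sections J q a ↔ ∃ k : ℕ, ∃ f ∈ J, f.IsHomogeneous (q + k * a.degree) ∧
      z * toFrac K n (monomial a 1) ^ k = toFrac K n f := by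
  simp only [← map_pow]
  rfl

theorem mem_sections_chart {J : Ideal (CoordRing K n)} {q : ℕ} {i : Fin (n + 1)} {z : Frac K n} :
    z ∈ sections J q (chart i) ↔ ∃ k : ℕ, ∃ f ∈ J, f.IsHomogeneous (q + k) ∧
      z * toFrac K n (X i) ^ k = toFrac K n f := by
  simp only [mem_sections, Finsupp.degree_single, mul_one]
  rfl

theorem mem_sections_overlap {J : Ideal (CoordRing K n)} {q : ℕ} {i j : Fin (n + 1)}
    {z : Frac K n} :
    z ∈ sections J q (overlap i j) ↔ ∃ k : ℕ, ∃ f ∈ J, f.IsHomogeneous (q + k * 2) ∧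
      z * toFrac K n (X i * X j) ^ k = toFrac K n f := by
  simp only [mem_sections, monomial_overlap, map_add, Finsupp.degree_single, Nat.reduceAdd]

theorem isHomogeneous_mul_monomial_pow {f : CoordRing K n} {q m : ℕ} {a : Fin (n + 1) →₀ ℕ}
    (hf : f.IsHomogeneous (q + m * a.degree)) (k : ℕ) :
    (f * monomial a 1 ^ k).IsHomogeneous (q + (m + k) * a.degree) := by
  have hmul := hf.mul ((isHomogeneous_monomial (1 : K) (rfl : a.degree = _)).pow k)
  rwa [show q + m * a.degree + a.degree * k = q + (m + k) * a.degree by ring] at hmul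

theorem mem_sections_of_mul_mem {J : Ideal (CoordRing K n)} {q : ℕ} {a : Fin (n + 1) →₀ ℕ}
    {z : Frac K n} (hz : z ∈ sections ⊤ q a) {k : ℕ} {f : CoordRing K n} (hf : f ∈ J)
    (hzf : z * toFrac K n (monomial a 1) ^ k = toFrac K n f) : z ∈ sections J q a := by
  obtain ⟨m, g, -, hg, hzg⟩ := mem_sections.mp hz
  have hgf : g * monomial a 1 ^ k = f * monomial a 1 ^ m := by
    apply toFrac_injective
    rw [map_mul, map_mul, ← hzf, ← hzg, map_pow, map_pow]
    ring
  refine mem_sections.mpr ⟨m + k, g * monomial a 1 ^ k, hgf ▸ J.mul_mem_right _ hf,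
    isHomogeneous_mul_monomial_pow hg k, ?_⟩
  rw [pow_add, map_mul, map_pow, ← mul_assoc, hzg]

theorem sections_le_top (J : Ideal (CoordRing K n)) (q : ℕ) (a : Fin (n + 1) →₀ ℕ) :
    sections J q a ≤ sections ⊤ q a := by
  rintro z ⟨k, f, -, hf⟩
  exact ⟨k, f, trivial, hf⟩

theorem eventually_of_mem_sections {J : Ideal (CoordRing K n)} {q : ℕ} {a : Fin (n + 1) →₀ ℕ}
    {z : Frac K n} (hz : z ∈ sections J q a) :
    ∀ᶠ k : ℕ in Filter.atTop, ∃ f ∈ J, f.IsHomogeneous (q + k * a.degree) ∧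
      z * toFrac K n (monomial a 1) ^ k = toFrac K n f := by
  obtain ⟨m, f, hfJ, hf, hzf⟩ := mem_sections.mp hz
  filter_upwards [Filter.eventually_ge_atTop m] with k hk
  obtain ⟨k, rfl⟩ := Nat.exists_eq_add_of_le hk
  refine ⟨f * monomial a 1 ^ k, J.mul_mem_right _ hfJ, isHomogeneous_mul_monomial_pow hf k, ?_⟩
  rw [map_mul, pow_add, ← mul_assoc, map_pow, hzf]

theorem sections_chart_le_overlap_left (q : ℕ) (i j : Fin (n + 1)) :
    sections (⊤ : Ideal (CoordRing K n)) q (chart i) ≤ sections ⊤ q (overlap i j) := by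
  intro z hz
  obtain ⟨k, f, -, hf, hzf⟩ := mem_sections_chart.mp hz
  refine mem_sections_overlap.mpr ⟨k, f * X j ^ k, trivial, ?_, ?_⟩
  · rw [mul_two, ← add_assoc]
    exact hf.mul (isHomogeneous_X_pow j k)
  · rw [map_mul, map_mul, mul_pow, ← mul_assoc, hzf, map_pow]

theorem sections_chart_le_overlap_right (q : ℕ) (i j : Fin (n + 1)) :
    sections (⊤ : Ideal (CoordRing K n)) q (chart j) ≤ sections ⊤ q (overlap i j) :=
  (sections_chart_le_overlap_left q j i).trans_eq (congrArg _ (add_comm (chart j) (chart i)))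

theorem exists_form_of_forall_mem_sections (hn : 1 ≤ n) {q : ℕ} {z : Frac K n}
    (hz : ∀ i, z ∈ sections (⊤ : Ideal (CoordRing K n)) q (chart i)) :
    ∃ f : CoordRing K n, f.IsHomogeneous q ∧ z = toFrac K n f := by
  obtain ⟨k, f, -, hf, hzf⟩ := mem_sections_chart.mp (hz 0)
  obtain ⟨m, g, -, -, hzg⟩ := mem_sections_chart.mp (hz (Fin.last n))
  have hfg : X 0 ^ k * g = f * X (Fin.last n) ^ m := by
    apply toFrac_injective
    rw [map_mul, map_mul, ← hzf, ← hzg, map_pow, map_pow]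
    ring
  have h0n : (0 : Fin (n + 1)) ≠ Fin.last n := by
    simp only [ne_eq, Fin.ext_iff, Fin.val_zero, Fin.val_last]
    omega
  obtain ⟨p, rfl⟩ : (X 0 ^ k : CoordRing K n) ∣ f :=
    Prime.pow_dvd_of_dvd_mul_right X_prime k
      (fun hdvd => h0n (X_dvd_X.mp (X_prime.dvd_of_dvd_pow hdvd))) ⟨g, hfg.symm⟩
  rw [mul_comm] at hf
  refine ⟨p, isHomogeneous_of_mul_X_pow hf, ?_⟩
  rw [map_mul, map_pow, mul_comm] at hzf
  exact mul_left_cancel₀ (pow_ne_zero k (toFrac_X_ne_zero 0)) hzf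

end Sections

section FirstCohomology

variable {K : Type*} [Field K]

section Remainder

variable {σ : Type*}

theorem exists_eq_mul_X_pow_add {f : MvPolynomial σ K} (i : σ) {k m : ℕ}
    (hf : f.IsHomogeneous (m + k)) :
    ∃ Q R : MvPolynomial σ K, Q.IsHomogeneous m ∧ R.IsHomogeneous (m + k) ∧
      f = Q * X i ^ k + R ∧ ∀ d : σ →₀ ℕ, k ≤ d i → R.coeff d = 0 := by
  classical
  have hR : (f.modMonomial (Finsupp.single i k)).IsHomogeneous (m + k) := by
    intro d hd
    by_cases hle : Finsupp.single i k ≤ d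
    · rw [coeff_modMonomial_of_le _ hle] at hd
      exact absurd rfl hd
    · rw [coeff_modMonomial_of_not_le _ hle] at hd
      exact hf hd
  have hdiv := divMonomial_add_modMonomial f (Finsupp.single i k)
  rw [← X_pow_eq_monomial, mul_comm] at hdiv
  refine ⟨f.divMonomial (Finsupp.single i k), f.modMonomial (Finsupp.single i k),
    isHomogeneous_of_mul_X_pow (i := i) (m := k) ?_, hR, hdiv.symm,
    fun d hd => coeff_modMonomial_of_le _ (Finsupp.single_le_iff.mpr hd)⟩
  rw [eq_sub_of_add_eq hdiv]
  exact hf.sub hR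

theorem coeff_mul_X_pow_eq_zero {R : MvPolynomial σ K} {i j : σ} (hij : i ≠ j) {k m : ℕ}
    (hR : ∀ d : σ →₀ ℕ, k ≤ d i → R.coeff d = 0) (d : σ →₀ ℕ) (hd : k ≤ d i) :
    (R * X j ^ m).coeff d = 0 := by
  classical
  rw [X_pow_eq_monomial, coeff_mul_monomial']
  split_ifs with h
  · rw [hR, zero_mul]
    rw [Finsupp.tsub_apply, Finsupp.single_eq_of_ne hij]
    simpa using hd
  · rfl

theorem coeff_mul_X_pow_eq_zero_of_lt {R : MvPolynomial σ K} {i : σ} {k : ℕ} (d : σ →₀ ℕ)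
    (hd : d i < k) : (R * X i ^ k).coeff d = 0 := by
  classical
  rw [X_pow_eq_monomial, coeff_mul_monomial',
    if_neg fun hle => hd.not_ge (Finsupp.single_le_iff.mp hle)]

theorem mul_X_pow_eq_mul_X_pow_of_dvd {R S : MvPolynomial σ K} {o i j : σ} (hi : i ≠ o)
    (hj : j ≠ o) {k : ℕ} (hR : ∀ d : σ →₀ ℕ, k ≤ d o → R.coeff d = 0)
    (hS : ∀ d : σ →₀ ℕ, k ≤ d o → S.coeff d = 0) (hdvd : X o ^ k ∣ S * X i ^ k - R * X j ^ k) :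
    S * X i ^ k = R * X j ^ k := by
  rw [← sub_eq_zero]
  ext d
  rw [coeff_zero]
  rcases le_or_gt k (d o) with hd | hd
  · rw [coeff_sub, coeff_mul_X_pow_eq_zero hi.symm hS d hd,
      coeff_mul_X_pow_eq_zero hj.symm hR d hd, sub_zero]
  · obtain ⟨g, hg⟩ := hdvd
    rw [hg, mul_comm, coeff_mul_X_pow_eq_zero_of_lt d hd]

end Remainder

variable {n : ℕ}

theorem X_last_pow_dvd {q k : ℕ} {R : Fin (n + 1) → CoordRing K n} (hn : 1 ≤ n)
    (hR : (R (Fin.last n)).IsHomogeneous (q + k + k))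
    (hR0 : ∀ d : Fin (n + 1) →₀ ℕ, k ≤ d 0 → (R (Fin.last n)).coeff d = 0)
    (hRR : ∀ j, j ≠ 0 → R j * X (Fin.last n) ^ k = R (Fin.last n) * X j ^ k) :
    X (Fin.last n) ^ k ∣ R (Fin.last n) := by
  have h0 : (0 : Fin (n + 1)) ≠ Fin.last n := by
    simp only [ne_eq, Fin.ext_iff, Fin.val_zero, Fin.val_last]
    omega
  rw [X_pow_eq_monomial, monomial_one_dvd_iff_modMonomial_eq_zero]
  ext d
  rw [coeff_zero]
  by_cases hle : Finsupp.single (Fin.last n) k ≤ d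
  · rw [coeff_modMonomial_of_le _ hle]
  rw [coeff_modMonomial_of_not_le _ hle]
  rw [Finsupp.single_le_iff, not_le] at hle
  by_cases hj : ∃ j : Fin (n + 1), j ≠ 0 ∧ j ≠ Fin.last n
  · obtain ⟨j, hj0, hjn⟩ := hj
    have hcoeff := congrArg (coeff (d + Finsupp.single j k)) (hRR j hj0)
    rw [X_pow_eq_monomial (n := j), coeff_mul_monomial, mul_one,
      coeff_mul_X_pow_eq_zero_of_lt _ (by simpa [hjn.symm] using hle)] at hcoeff
    exact hcoeff.symm
  · push Not at hj
    by_contra hne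
    have hd0 : d 0 < k := lt_of_not_ge fun hd => hne (hR0 d hd)
    have hdeg : d.degree = d 0 + d (Fin.last n) := by
      rw [Finsupp.degree_eq_sum]
      exact Fintype.sum_eq_add 0 (Fin.last n) h0 fun i hi => absurd (hj i hi.1) hi.2
    have := hdeg.symm.trans (not_imp_comm.mp hR.coeff_eq_zero hne)
    omega

theorem exists_eq_mul_X_pow {q k : ℕ} {R : Fin (n + 1) → CoordRing K n} (hn : 1 ≤ n)
    (hR : ∀ i, (R i).IsHomogeneous (q + k + k))
    (hR0 : ∀ i, ∀ d : Fin (n + 1) →₀ ℕ, k ≤ d 0 → (R i).coeff d = 0)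
    (hRR : ∀ i j, i ≠ 0 → j ≠ 0 → R j * X i ^ k = R i * X j ^ k) :
    ∃ P : CoordRing K n, P.IsHomogeneous (q + k) ∧ ∀ i, i ≠ 0 → R i = P * X i ^ k := by
  have hlast : Fin.last n ≠ 0 := by
    simp only [ne_eq, Fin.ext_iff, Fin.val_zero, Fin.val_last]
    omega
  obtain ⟨P, hP⟩ := X_last_pow_dvd hn (hR _) (hR0 _) fun j hj => hRR _ j hlast hj
  rw [mul_comm] at hP
  refine ⟨P, isHomogeneous_of_mul_X_pow (hP ▸ hR _), fun i hi => ?_⟩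
  refine mul_right_cancel₀ (pow_ne_zero k (X_ne_zero (Fin.last n))) ?_
  rw [hRR _ i hlast hi, hP]
  ring

theorem exists_common_denominator {q : ℕ} {c : Fin (n + 1) → Fin (n + 1) → Frac K n}
    (hc : ∀ i j, c i j ∈ sections (⊤ : Ideal (CoordRing K n)) q (overlap i j)) :
    ∃ (k : ℕ) (f : Fin (n + 1) → Fin (n + 1) → CoordRing K n),
      (∀ i j, (f i j).IsHomogeneous (q + k + k)) ∧
      ∀ i j, c i j * (toFrac K n (X i) * toFrac K n (X j)) ^ k = toFrac K n (f i j) := by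
  have hev : ∀ᶠ k : ℕ in Filter.atTop, ∀ i j, ∃ f : CoordRing K n, f.IsHomogeneous (q + k + k) ∧
      c i j * (toFrac K n (X i) * toFrac K n (X j)) ^ k = toFrac K n f := by
    refine Filter.eventually_all.mpr fun i => Filter.eventually_all.mpr fun j => ?_
    filter_upwards [eventually_of_mem_sections (hc i j)] with k ⟨f, _, hf, hcf⟩
    rw [monomial_overlap, map_mul] at hcf
    rw [map_add, Finsupp.degree_single, Finsupp.degree_single,
      show q + k * (1 + 1) = q + k + k by ring] at hf
    exact ⟨f, hf, hcf⟩
  obtain ⟨k, hk⟩ := hev.exists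
  choose f hf hcf using hk
  exact ⟨k, f, hf, hcf⟩

/-- The vanishing of `H¹(ℙⁿ, 𝓞(q))`. -/
theorem exists_eq_sub_of_cocycle (hn : 1 ≤ n) {q : ℕ} {c : Fin (n + 1) → Fin (n + 1) → Frac K n}
    (hc : ∀ i j, c i j ∈ sections (⊤ : Ideal (CoordRing K n)) q (overlap i j))
    (hcc : ∀ i j k, c i j + c j k = c i k) :
    ∃ b : Fin (n + 1) → Frac K n,
      (∀ i, b i ∈ sections (⊤ : Ideal (CoordRing K n)) q (chart i)) ∧
      ∀ i j, c i j = b j - b i := by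
  obtain ⟨k, f, hf, hcf⟩ := exists_common_denominator hc
  choose Q R hQ hR hfQR hR0 using fun i => exists_eq_mul_X_pow_add (0 : Fin (n + 1)) (hf 0 i)
  have hff : ∀ i j, f 0 j * X i ^ k - f 0 i * X j ^ k = f i j * X 0 ^ k := by
    intro i j
    apply toFrac_injective
    simp only [map_sub, map_mul, map_pow, ← hcf, ← hcc 0 i j]
    ring
  have hRR : ∀ i j, i ≠ 0 → j ≠ 0 → R j * X i ^ k = R i * X j ^ k := fun i j hi hj =>
    mul_X_pow_eq_mul_X_pow_of_dvd hi hj (hR0 i) (hR0 j)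
      ⟨f i j - Q j * X i ^ k + Q i * X j ^ k, by
        linear_combination hff i j - X i ^ k * hfQR j + X j ^ k * hfQR i⟩
  obtain ⟨P, hP, hRP⟩ := exists_eq_mul_X_pow hn hR hR0 hRR
  have hX : ∀ i, toFrac K n (X i) ^ k ≠ 0 := fun i => pow_ne_zero _ (toFrac_X_ne_zero i)
  let b₀ : Frac K n := -(toFrac K n P / toFrac K n (X 0) ^ k)
  have hb₀ : b₀ ∈ sections (⊤ : Ideal (CoordRing K n)) q (chart 0) :=
    mem_sections_chart.mpr ⟨k, -P, trivial, hP.neg, by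
      rw [neg_mul, div_mul_cancel₀ _ (hX 0), map_neg]⟩
  refine ⟨fun i => b₀ + c 0 i, fun i => ?_, fun i j => by linear_combination hcc 0 i j⟩
  rcases eq_or_ne i 0 with rfl | hi
  · have hc0 : c 0 0 = 0 := by simpa using hcc 0 0 0
    simpa only [hc0, add_zero]
  · refine mem_sections_chart.mpr ⟨k, Q i, trivial, hQ i, ?_⟩
    have hcQ := hcf 0 i
    rw [hfQR i, hRP i hi, map_add, map_mul, map_mul, map_pow, map_pow, mul_pow] at hcQ
    refine mul_right_cancel₀ (hX 0) ?_
    have hb₀P : b₀ * toFrac K n (X 0) ^ k = -toFrac K n P := by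
      rw [neg_mul, div_mul_cancel₀ _ (hX 0)]
    linear_combination hcQ + toFrac K n (X i) ^ k * hb₀P

end FirstCohomology

section Dehomogenization

variable {K : Type*} [Field K] {σ : Type*}

/-- The homogenization in degree `M` with respect to a linear form `l`: the components of degree
`i ≤ M` are multiplied by `l ^ (M - i)`, and those of larger degree are discarded. -/
def homogenization (l : MvPolynomial σ K) (M : ℕ) : MvPolynomial σ K →ₗ[K] MvPolynomial σ K :=
  ∑ i ∈ Finset.range (M + 1), LinearMap.mulLeft K (l ^ (M - i)) ∘ₗ homogeneousComponent i

theorem homogenization_apply (l : MvPolynomial σ K) (M : ℕ) (f : MvPolynomial σ K) :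
    homogenization l M f =
      ∑ i ∈ Finset.range (M + 1), l ^ (M - i) * homogeneousComponent i f := by
  simp [homogenization]

theorem homogenization_isHomogeneous {l : MvPolynomial σ K} (hl : l.IsHomogeneous 1) (M : ℕ)
    (f : MvPolynomial σ K) : (homogenization l M f).IsHomogeneous M := by
  rw [homogenization_apply]
  refine IsHomogeneous.sum _ _ _ fun i hi => ?_
  have hmul := (hl.pow (M - i)).mul (homogeneousComponent_isHomogeneous i f)
  rwa [one_mul, Nat.sub_add_cancel (Nat.le_of_lt_succ (Finset.mem_range.mp hi))] at hmul

theorem homogenization_of_isHomogeneous (l : MvPolynomial σ K) {f : MvPolynomial σ K} {k M : ℕ}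
    (hf : f.IsHomogeneous k) (hk : k ≤ M) : homogenization l M f = l ^ (M - k) * f := by
  rw [homogenization_apply, Finset.sum_eq_single k]
  · rw [homogeneousComponent_eq_self hf]
  · intro i _ hik
    rw [homogeneousComponent_of_mem hf, if_neg hik, mul_zero]
  · exact fun hk' => absurd (Finset.mem_range.mpr (Nat.lt_succ_of_le hk)) hk'

theorem homogenization_mul_sub_one {l : MvPolynomial σ K} (hl : l.IsHomogeneous 1)
    {f : MvPolynomial σ K} {M : ℕ} (hM : f.totalDegree < M) :
    homogenization l M (f * (l - 1)) = 0 := by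
  have hzero : homogeneousComponent 0 (f * l) = 0 := by
    have hl0 : constantCoeff l = 0 := hl.coeff_eq_zero (by simp)
    rw [homogeneousComponent_zero, ← constantCoeff_eq, map_mul, hl0, mul_zero, C_0]
  rw [mul_sub, mul_one, map_sub, sub_eq_zero, homogenization_apply, homogenization_apply,
    Finset.sum_range_succ', hzero, mul_zero, add_zero, Finset.sum_range_succ,
    homogeneousComponent_eq_zero _ _ hM, mul_zero, add_zero]
  refine Finset.sum_congr rfl fun i hi => ?_
  rw [homogeneousComponent_mul_of_isHomogeneous hl, mul_comm (homogeneousComponent i f),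
    ← mul_assoc, ← pow_succ, show M - (i + 1) + 1 = M - i by rw [Finset.mem_range] at hi; omega]

theorem sub_homogenization_mem_span (l f : MvPolynomial σ K) :
    f - homogenization l f.totalDegree f ∈ Ideal.span {l - 1} := by
  nth_rw 1 [← sum_homogeneousComponent f]
  rw [homogenization_apply, ← Finset.sum_sub_distrib]
  refine Ideal.sum_mem _ fun i _ => ?_
  rw [← one_sub_mul, ← neg_sub (l ^ _), neg_mul, neg_mem_iff]
  exact Ideal.mul_mem_right _ _ (Ideal.mem_span_singleton.mpr (sub_one_dvd_pow_sub_one l _))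

theorem exists_isHomogeneous_sub_mem_span {l : MvPolynomial σ K} (hl : l.IsHomogeneous 1)
    (f : MvPolynomial σ K) :
    ∃ (k : ℕ) (g : MvPolynomial σ K), g.IsHomogeneous k ∧ f - g ∈ Ideal.span {l - 1} :=
  ⟨_, _, homogenization_isHomogeneous hl _ f, sub_homogenization_mem_span l f⟩

/-- The ideal of the affine part `l = 1` of the cone defined by `J`. -/
abbrev affineIdeal (J : Ideal (MvPolynomial σ K)) (l : MvPolynomial σ K) :
    Ideal (MvPolynomial σ K) :=
  J ⊔ Ideal.span {l - 1}

theorem mk_affineIdeal_self (J : Ideal (MvPolynomial σ K)) (l : MvPolynomial σ K) :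
    Ideal.Quotient.mk (affineIdeal J l) l = 1 := by
  rw [← map_one (Ideal.Quotient.mk (affineIdeal J l)), Ideal.Quotient.eq]
  exact Ideal.mem_sup_right (Ideal.mem_span_singleton_self _)

theorem exists_pow_mul_mem_of_mem_affineIdeal {J : Ideal (MvPolynomial σ K)}
    (hJ : ∀ f ∈ J, ∀ m : ℕ, homogeneousComponent m f ∈ J) {l : MvPolynomial σ K}
    (hl : l.IsHomogeneous 1) {f : MvPolynomial σ K} {k : ℕ} (hf : f.IsHomogeneous k)
    (hfJ : f ∈ affineIdeal J l) : ∃ m : ℕ, l ^ m * f ∈ J := by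
  obtain ⟨g, hg, h, hh, rfl⟩ := Submodule.mem_sup.mp hfJ
  obtain ⟨c, rfl⟩ := Ideal.mem_span_singleton'.mp hh
  let M := k + c.totalDegree + 1
  refine ⟨M - k, ?_⟩
  rw [← homogenization_of_isHomogeneous l hf (by omega), map_add,
    homogenization_mul_sub_one hl (by omega), add_zero, homogenization_apply]
  exact Ideal.sum_mem _ fun i _ => J.mul_mem_left _ (hJ g hg i)

theorem span_range_mk_X_eq_top {l : MvPolynomial σ K} (hl : l.IsHomogeneous 1)
    (J : Ideal (MvPolynomial σ K)) :
    Ideal.span (Set.range fun i => Ideal.Quotient.mk (affineIdeal J l) (X i)) = ⊤ := by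
  have hlX : l ∈ Ideal.span (Set.range (X : σ → MvPolynomial σ K)) :=
    Submodule.span_le_restrictScalars K (MvPolynomial σ K) _
      (homogeneousSubmodule_one_eq_span_X (σ := σ) (R := K) ▸ hl)
  have hmap := Ideal.mem_map_of_mem (Ideal.Quotient.mk (affineIdeal J l)) hlX
  rwa [Ideal.map_span, ← Set.range_comp, mk_affineIdeal_self, ← Ideal.eq_top_iff_one] at hmap

end Dehomogenization

section UnimodularFamilies

variable {A ι : Type*} [CommRing A] [Finite ι] {a : ι → A}

theorem exists_forall_pow_mul_eq (ha : Ideal.span (Set.range a) = ⊤) {k : ℕ} {φ : ι → A}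
    (hφ : ∀ i j, φ j * a i ^ k = φ i * a j ^ k) : ∃ α : A, ∀ i, a i ^ k * α = φ i := by
  have := Fintype.ofFinite ι
  have hone := Ideal.span_pow_eq_top _ ha k
  rw [← Set.range_comp, Ideal.eq_top_iff_one, Ideal.mem_span_range_iff_exists_fun] at hone
  obtain ⟨c, hc⟩ := hone
  refine ⟨∑ j, c j * φ j, fun i => ?_⟩
  calc a i ^ k * ∑ j, c j * φ j = φ i * ∑ j, c j * a j ^ k := by
        rw [Finset.mul_sum, Finset.mul_sum]
        exact Finset.sum_congr rfl fun j _ => by linear_combination c j * hφ i j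
    _ = φ i := by rw [show ∑ j, c j * a j ^ k = 1 from hc, mul_one]

theorem eq_zero_of_forall_pow_mul_eq_zero (ha : Ideal.span (Set.range a) = ⊤) {y : A}
    (hy : ∀ i, ∃ m : ℕ, a i ^ m * y = 0) : y = 0 := by
  have := Fintype.ofFinite ι
  choose m hm using hy
  have hle : Ideal.span ((· ^ (∑ i, m i)) '' Set.range a) ≤
      LinearMap.ker (LinearMap.mulRight A y) := by
    rw [Ideal.span_le]
    rintro _ ⟨_, ⟨i, rfl⟩, rfl⟩
    obtain ⟨c, hc⟩ := Nat.exists_eq_add_of_le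
      (Finset.single_le_sum (f := m) (fun _ _ => Nat.zero_le _) (Finset.mem_univ i))
    simp only [SetLike.mem_coe, LinearMap.mem_ker, LinearMap.mulRight_apply]
    rw [hc, pow_add, mul_right_comm, hm, zero_mul]
  rw [Ideal.span_pow_eq_top _ ha] at hle
  simpa using hle (x := 1) trivial

end UnimodularFamilies

section Gluing

variable {K : Type*} [Field K] {n : ℕ}

theorem mem_sections_chart_iff {J : Ideal (CoordRing K n)} {q k : ℕ} {i : Fin (n + 1)}
    {z : Frac K n} {f : CoordRing K n} (hf : f.IsHomogeneous (q + k))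
    (hzf : z * toFrac K n (X i) ^ k = toFrac K n f) :
    z ∈ sections J q (chart i) ↔ ∃ m : ℕ, X i ^ m * f ∈ J := by
  constructor
  · intro hz
    obtain ⟨m, g, hg, -, hzg⟩ := mem_sections_chart.mp hz
    refine ⟨m, ?_⟩
    have hfg : X i ^ m * f = g * X i ^ k := by
      apply toFrac_injective
      rw [map_mul, map_mul, ← hzf, ← hzg, map_pow, map_pow]
      ring
    exact hfg ▸ J.mul_mem_right _ hg
  · rintro ⟨m, hm⟩
    refine mem_sections_chart.mpr ⟨m + k, _, hm, ?_, ?_⟩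
    · rw [add_left_comm]
      exact (isHomogeneous_X_pow i m).mul hf
    · rw [map_mul, ← hzf, map_pow]
      ring

theorem mul_mem_sections {J : Ideal (CoordRing K n)} {p q : ℕ} {a : Fin (n + 1) →₀ ℕ}
    {y z : Frac K n} (hy : y ∈ sections ⊤ p a) (hz : z ∈ sections J q a) :
    y * z ∈ sections J (p + q) a := by
  obtain ⟨k, f, -, hf, hyf⟩ := mem_sections.mp hy
  obtain ⟨m, g, hgJ, hg, hzg⟩ := mem_sections.mp hz
  refine mem_sections.mpr ⟨k + m, f * g, J.mul_mem_left _ hgJ, ?_, ?_⟩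
  · rw [show p + q + (k + m) * a.degree = p + k * a.degree + (q + m * a.degree) by ring]
    exact hf.mul hg
  · rw [map_mul, ← hyf, ← hzg]
    ring

/-- Families of sections of `𝓞(q)` over the `D₊(x_i)` that agree modulo `𝓙(q)` on the overlaps;
for `q = 0` these are the `quotientCocycles`. -/
def twistedCocycles (J : Ideal (CoordRing K n)) (q : ℕ) :
    Submodule K (Fin (n + 1) → Frac K n) where
  carrier := {s | (∀ i, s i ∈ sections ⊤ q (chart i)) ∧
    ∀ i j, s j - s i ∈ sections J q (overlap i j)}
  zero_mem' := ⟨fun _ => Submodule.zero_mem _, fun _ _ => by simp⟩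
  add_mem' := by
    rintro s t ⟨hs, hs'⟩ ⟨ht, ht'⟩
    refine ⟨fun i => Submodule.add_mem _ (hs i) (ht i), fun i j => ?_⟩
    simpa only [Pi.add_apply, add_sub_add_comm] using Submodule.add_mem _ (hs' i j) (ht' i j)
  smul_mem' := by
    rintro c s ⟨hs, hs'⟩
    refine ⟨fun i => Submodule.smul_mem _ c (hs i), fun i j => ?_⟩
    simpa only [Pi.smul_apply, smul_sub] using Submodule.smul_mem _ c (hs' i j)

theorem exists_common_denominator_of_mem_twistedCocycles {J : Ideal (CoordRing K n)} {q : ℕ}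
    {s : Fin (n + 1) → Frac K n} (hs : s ∈ twistedCocycles J q) :
    ∃ (k : ℕ) (f : Fin (n + 1) → CoordRing K n), (∀ i, (f i).IsHomogeneous (q + k)) ∧
      (∀ i, s i * toFrac K n (X i) ^ k = toFrac K n (f i)) ∧
      ∀ i j, f j * X i ^ k - f i * X j ^ k ∈ J := by
  have hev : ∀ᶠ k : ℕ in Filter.atTop,
      (∀ i, ∃ f : CoordRing K n, f.IsHomogeneous (q + k) ∧
        s i * toFrac K n (X i) ^ k = toFrac K n f) ∧
      ∀ i j, ∃ h ∈ J, (s j - s i) * (toFrac K n (X i) * toFrac K n (X j)) ^ k = toFrac K n h := by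
    refine Filter.eventually_and.mpr ⟨Filter.eventually_all.mpr fun i => ?_,
      Filter.eventually_all.mpr fun i => Filter.eventually_all.mpr fun j => ?_⟩
    · filter_upwards [eventually_of_mem_sections (hs.1 i)] with k ⟨f, _, hf, hsf⟩
      exact ⟨f, by simpa using hf, hsf⟩
    · filter_upwards [eventually_of_mem_sections (hs.2 i j)] with k ⟨h, hh, _, hsh⟩
      rw [monomial_overlap, map_mul] at hsh
      exact ⟨h, hh, hsh⟩
  obtain ⟨k, hk, hkJ⟩ := hev.exists
  choose f hf hsf using hk
  refine ⟨k, f, hf, hsf, fun i j => ?_⟩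
  obtain ⟨h, hh, hsh⟩ := hkJ i j
  rwa [show f j * X i ^ k - f i * X j ^ k = h by
    apply toFrac_injective
    rw [← hsh, map_sub, map_mul, map_mul, ← hsf, ← hsf, map_pow, map_pow]
    ring]

theorem exists_form_mk_eq {J : Ideal (CoordRing K n)} {l : CoordRing K n}
    (hl : l.IsHomogeneous 1) {k : ℕ} {f : Fin (n + 1) → CoordRing K n}
    (hfJ : ∀ i j, f j * X i ^ k - f i * X j ^ k ∈ J) :
    ∃ (e : ℕ) (g : CoordRing K n), g.IsHomogeneous e ∧
      ∀ i, X i ^ k * g - f i ∈ affineIdeal J l := by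
  obtain ⟨α, hα⟩ := exists_forall_pow_mul_eq (k := k)
    (φ := fun i => Ideal.Quotient.mk (affineIdeal J l) (f i))
    (span_range_mk_X_eq_top hl J) fun i j => by
      rw [← map_pow, ← map_pow, ← map_mul, ← map_mul, Ideal.Quotient.eq]
      exact Ideal.mem_sup_left (hfJ i j)
  obtain ⟨g₀, rfl⟩ := Ideal.Quotient.mk_surjective α
  obtain ⟨e, g, hg, hgg⟩ := exists_isHomogeneous_sub_mem_span hl g₀
  rw [Ideal.Quotient.eq.mpr (Ideal.mem_sup_right hgg : g₀ - g ∈ affineIdeal J l)] at hα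
  refine ⟨e, g, hg, fun i => Ideal.Quotient.eq.mp ?_⟩
  rw [map_mul, map_pow, hα]

/-- Data witnessing that the linear form `l` is invertible on the subscheme defined by the
homogeneous ideal `J`: on the chart `D₊(x_i)` the inverse of `l` is `(inv i) / x_i ^ (N + 1)`. -/
structure InvertibleForm (J : Ideal (CoordRing K n)) (l : CoordRing K n) where
  homogeneous : ∀ f ∈ J, ∀ m : ℕ, homogeneousComponent m f ∈ J
  isHomogeneous : l.IsHomogeneous 1
  N : ℕ
  inv : Fin (n + 1) → CoordRing K n
  isHomogeneous_inv : ∀ i, (inv i).IsHomogeneous N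
  sub_mem : ∀ i, X i ^ (N + 1) - l * inv i ∈ J

theorem nonempty_invertibleForm {J : Ideal (CoordRing K n)}
    (hJ : ∀ f ∈ J, ∀ m : ℕ, homogeneousComponent m f ∈ J) {l : CoordRing K n}
    (hl : l.IsHomogeneous 1) (hX : ∀ i, ∃ N : ℕ, X i ^ N ∈ J ⊔ Ideal.span {l}) :
    Nonempty (InvertibleForm J l) := by
  choose N hN using hX
  have exists_inv : ∀ i, ∃ g : CoordRing K n, g.IsHomogeneous (∑ i, N i) ∧
      X i ^ ((∑ i, N i) + 1) - l * g ∈ J := by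
    intro i
    have hXi : X i ^ ((∑ i, N i) + 1) ∈ J ⊔ Ideal.span {l} :=
      Ideal.pow_mem_of_pow_mem _ (hN i)
        ((Finset.single_le_sum (fun _ _ => Nat.zero_le _) (Finset.mem_univ i)).trans
          (Nat.le_succ _))
    obtain ⟨f, hf, g, hg, hfg⟩ := Submodule.mem_sup.mp hXi
    obtain ⟨g, rfl⟩ := Ideal.mem_span_singleton'.mp hg
    refine ⟨homogeneousComponent (∑ i, N i) g, homogeneousComponent_isHomogeneous _ _, ?_⟩
    have hcomp := hJ f hf ((∑ i, N i) + 1)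
    rwa [eq_sub_of_add_eq hfg, map_sub, homogeneousComponent_mul_of_isHomogeneous hl,
      homogeneousComponent_eq_self (isHomogeneous_X_pow i _), mul_comm] at hcomp
  choose g hg hgJ using exists_inv
  exact ⟨⟨hJ, hl, _, g, hg, hgJ⟩⟩

namespace InvertibleForm

variable {J : Ideal (CoordRing K n)} {l : CoordRing K n} (D : InvertibleForm J l)

theorem mk_X_pow (i : Fin (n + 1)) (e : ℕ) :
    Ideal.Quotient.mk J (X i) ^ ((D.N + 1) * e) =
      Ideal.Quotient.mk J l ^ e * Ideal.Quotient.mk J (D.inv i) ^ e := by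
  have hmk := Ideal.Quotient.eq.mpr (D.sub_mem i)
  rw [map_pow, map_mul] at hmk
  rw [pow_mul, hmk, mul_pow]

include D in
theorem exists_X_pow_mul_mem {m : ℕ} {f : CoordRing K n} (hf : l ^ m * f ∈ J)
    (i : Fin (n + 1)) : ∃ p : ℕ, X i ^ p * f ∈ J := by
  refine ⟨(D.N + 1) * m, ?_⟩
  rw [← Ideal.Quotient.eq_zero_iff_mem] at hf ⊢
  simp only [map_mul, map_pow, D.mk_X_pow] at hf ⊢
  linear_combination Ideal.Quotient.mk J (D.inv i) ^ m * hf

/-- The inverse of `l` on the chart `D₊(x_i)`, up to elements of the ideal sheaf. -/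
def fracInv (i : Fin (n + 1)) : Frac K n :=
  toFrac K n (D.inv i) / toFrac K n (X i) ^ (D.N + 1)

theorem fracInv_pow_mul (i : Fin (n + 1)) (e : ℕ) :
    D.fracInv i ^ e * toFrac K n (X i) ^ ((D.N + 1) * e) = toFrac K n (D.inv i) ^ e := by
  rw [pow_mul, ← mul_pow, fracInv, div_mul_cancel₀ _ (pow_ne_zero _ (toFrac_X_ne_zero i))]

theorem fracInv_mul_sub_one_mem (i : Fin (n + 1)) :
    D.fracInv i * toFrac K n l - 1 ∈ sections J 0 (chart i) := by
  refine mem_sections_chart.mpr ⟨D.N + 1, l * D.inv i - X i ^ (D.N + 1), ?_, ?_, ?_⟩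
  · rw [← neg_sub, neg_mem_iff]
    exact D.sub_mem i
  · refine IsHomogeneous.sub ?_ (by simpa using isHomogeneous_X_pow i (D.N + 1))
    simpa only [zero_add, add_comm] using D.isHomogeneous.mul (D.isHomogeneous_inv i)
  · have hinv := D.fracInv_pow_mul i 1
    rw [mul_one, pow_one, pow_one] at hinv
    rw [map_sub, map_mul, map_pow]
    linear_combination toFrac K n l * hinv

/-- The family of sections of `𝓞(q)` representing `l ^ q * f(x / l)`. -/
def glue (q : ℕ) : CoordRing K n →ₗ[K] (Fin (n + 1) → Frac K n) :=
  LinearMap.pi fun i => LinearMap.mulLeft K (toFrac K n l ^ q) ∘ₗ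
    (aeval fun j => D.fracInv i * toFrac K n (X j)).toLinearMap

theorem aeval_fracInv_mul {f : CoordRing K n} {e : ℕ} (hf : f.IsHomogeneous e)
    (i : Fin (n + 1)) :
    aeval (fun j => D.fracInv i * toFrac K n (X j)) f = D.fracInv i ^ e * toFrac K n f := by
  rw [aeval_mul_of_isHomogeneous hf]
  exact congrArg _ (DFunLike.congr_fun (aeval_unique (toFrac K n)) f).symm

theorem glue_apply_mul (q : ℕ) {f : CoordRing K n} {e : ℕ} (hf : f.IsHomogeneous e)
    (i : Fin (n + 1)) :
    D.glue q f i * toFrac K n (X i) ^ ((D.N + 1) * e) = toFrac K n (l ^ q * f * D.inv i ^ e) := by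
  change toFrac K n l ^ q * aeval (fun j => D.fracInv i * toFrac K n (X j)) f * _ = _
  rw [D.aeval_fracInv_mul hf, map_mul, map_mul, map_pow, map_pow, ← D.fracInv_pow_mul]
  ring

theorem glue_mul_sub_one (q : ℕ) (f : CoordRing K n) (i : Fin (n + 1)) :
    D.glue q (f * (l - 1)) i = D.glue q f i * (D.fracInv i * toFrac K n l - 1) := by
  change toFrac K n l ^ q * aeval _ (f * (l - 1)) = toFrac K n l ^ q * aeval _ f * _
  rw [map_mul, map_sub, map_one, D.aeval_fracInv_mul D.isHomogeneous, pow_one, mul_assoc]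

theorem glue_eq_sum (q : ℕ) (f : CoordRing K n) (i : Fin (n + 1)) :
    D.glue q f i =
      ∑ e ∈ Finset.range (f.totalDegree + 1), D.glue q (homogeneousComponent e f) i := by
  rw [← Finset.sum_apply, ← map_sum, sum_homogeneousComponent]

theorem isHomogeneous_glue_numerator (q : ℕ) {f : CoordRing K n} {e : ℕ} (hf : f.IsHomogeneous e)
    (i : Fin (n + 1)) : (l ^ q * f * D.inv i ^ e).IsHomogeneous (q + (D.N + 1) * e) := by
  have hmul := ((D.isHomogeneous.pow q).mul hf).mul ((D.isHomogeneous_inv i).pow e)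
  rwa [show 1 * q + e + D.N * e = q + (D.N + 1) * e by ring] at hmul

theorem glue_mem_sections_top (q : ℕ) (f : CoordRing K n) (i : Fin (n + 1)) :
    D.glue q f i ∈ sections ⊤ q (chart i) := by
  rw [D.glue_eq_sum]
  refine Submodule.sum_mem _ fun e _ => ?_
  have hf := homogeneousComponent_isHomogeneous e f
  exact mem_sections_chart.mpr
    ⟨_, _, trivial, D.isHomogeneous_glue_numerator q hf i, D.glue_apply_mul q hf i⟩

theorem glue_mem_twistedCocycles (q : ℕ) (f : CoordRing K n) :
    D.glue q f ∈ twistedCocycles J q := by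
  refine ⟨D.glue_mem_sections_top q f, fun i j => ?_⟩
  rw [D.glue_eq_sum, D.glue_eq_sum, ← Finset.sum_sub_distrib]
  refine Submodule.sum_mem _ fun e _ => ?_
  have hf := homogeneousComponent_isHomogeneous e f
  set g := homogeneousComponent e f
  refine mem_sections_of_mul_mem (k := (D.N + 1) * e)
    (f := l ^ q * g * D.inv j ^ e * X i ^ ((D.N + 1) * e) -
      l ^ q * g * D.inv i ^ e * X j ^ ((D.N + 1) * e))
    (Submodule.sub_mem _ (sections_chart_le_overlap_right q i j (D.glue_mem_sections_top q g j))
      (sections_chart_le_overlap_left q i j (D.glue_mem_sections_top q g i))) ?_ ?_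
  · rw [← Ideal.Quotient.eq_zero_iff_mem]
    simp only [map_sub, map_mul, map_pow, D.mk_X_pow]
    ring
  · rw [monomial_overlap, map_sub, map_mul _ _ (X i ^ _), map_mul _ _ (X j ^ _), map_mul _ (X i),
      ← D.glue_apply_mul q hf, ← D.glue_apply_mul q hf, map_pow, map_pow]
    ring

theorem glue_mem_sections_iff_of_isHomogeneous (q : ℕ) {f : CoordRing K n} {e : ℕ}
    (hf : f.IsHomogeneous e) (i : Fin (n + 1)) :
    D.glue q f i ∈ sections J q (chart i) ↔ ∃ m : ℕ, X i ^ m * f ∈ J := by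
  rw [mem_sections_chart_iff (D.isHomogeneous_glue_numerator q hf i) (D.glue_apply_mul q hf i)]
  constructor
  · rintro ⟨m, hm⟩
    refine ⟨m + (D.N + 1) * q + (D.N + 1) * e, ?_⟩
    rw [← Ideal.Quotient.eq_zero_iff_mem] at hm ⊢
    simp only [map_mul, map_pow, pow_add, D.mk_X_pow] at hm ⊢
    linear_combination Ideal.Quotient.mk J (D.inv i) ^ q * Ideal.Quotient.mk J l ^ e * hm
  · rintro ⟨m, hm⟩
    refine ⟨m, ?_⟩
    rw [show X i ^ m * (l ^ q * f * D.inv i ^ e) = l ^ q * D.inv i ^ e * (X i ^ m * f) by ring]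
    exact J.mul_mem_left _ hm

theorem glue_mem_sections_of_mem (q : ℕ) {f : CoordRing K n} (hf : f ∈ affineIdeal J l)
    (i : Fin (n + 1)) : D.glue q f i ∈ sections J q (chart i) := by
  obtain ⟨g, hg, h, hh, rfl⟩ := Submodule.mem_sup.mp hf
  obtain ⟨c, rfl⟩ := Ideal.mem_span_singleton'.mp hh
  rw [map_add, Pi.add_apply]
  refine Submodule.add_mem _ ?_ ?_
  · rw [D.glue_eq_sum]
    refine Submodule.sum_mem _ fun e _ =>
      (D.glue_mem_sections_iff_of_isHomogeneous q (homogeneousComponent_isHomogeneous e g) i).mpr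
        ⟨0, J.mul_mem_left _ (D.homogeneous g hg e)⟩
  · rw [D.glue_mul_sub_one]
    exact mul_mem_sections (D.glue_mem_sections_top q c i) (D.fracInv_mul_sub_one_mem i)

theorem forall_glue_mem_sections_iff (q : ℕ) {f : CoordRing K n} :
    (∀ i, D.glue q f i ∈ sections J q (chart i)) ↔ f ∈ affineIdeal J l := by
  refine ⟨fun hf => ?_, fun hf i => D.glue_mem_sections_of_mem q hf i⟩
  obtain ⟨e, g, hg, hfg⟩ := exists_isHomogeneous_sub_mem_span D.isHomogeneous f
  have hfg' : f - g ∈ affineIdeal J l := Ideal.mem_sup_right hfg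
  have hgs : ∀ i, D.glue q g i ∈ sections J q (chart i) := fun i => by
    have hsub := Submodule.sub_mem _ (hf i) (D.glue_mem_sections_of_mem q hfg' i)
    rwa [map_sub, Pi.sub_apply, sub_sub_cancel] at hsub
  suffices hgJ : g ∈ affineIdeal J l by simpa only [sub_add_cancel] using add_mem hfg' hgJ
  rw [← Ideal.Quotient.eq_zero_iff_mem]
  refine eq_zero_of_forall_pow_mul_eq_zero (span_range_mk_X_eq_top D.isHomogeneous J) fun i => ?_
  obtain ⟨m, hm⟩ := (D.glue_mem_sections_iff_of_isHomogeneous q hg i).mp (hgs i)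
  refine ⟨m, ?_⟩
  rw [← map_pow, ← map_mul, Ideal.Quotient.eq_zero_iff_mem]
  exact Ideal.mem_sup_left hm

theorem exists_glue_sub_mem (q : ℕ) {s : Fin (n + 1) → Frac K n} (hs : s ∈ twistedCocycles J q) :
    ∃ f, ∀ i, D.glue q f i - s i ∈ sections J q (chart i) := by
  obtain ⟨k, f, hf, hsf, hfJ⟩ := exists_common_denominator_of_mem_twistedCocycles hs
  obtain ⟨e, g, hg, hgf⟩ := exists_form_mk_eq D.isHomogeneous hfJ
  refine ⟨g, fun i => ?_⟩
  have hP : (l ^ q * (X i ^ k * g) - l ^ e * f i).IsHomogeneous (q + k + e) := by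
    refine IsHomogeneous.sub ?_ ?_
    · have hmul := (D.isHomogeneous.pow q).mul ((isHomogeneous_X_pow i k).mul hg)
      rwa [one_mul, ← add_assoc] at hmul
    · have hmul := (D.isHomogeneous.pow e).mul (hf i)
      rwa [one_mul, add_comm e] at hmul
  have hPJ : l ^ q * (X i ^ k * g) - l ^ e * f i ∈ affineIdeal J l := by
    have hgf' := Ideal.Quotient.eq.mpr (hgf i)
    rw [← Ideal.Quotient.eq]
    simp only [map_mul, map_pow, mk_affineIdeal_self, one_pow, one_mul] at hgf' ⊢
    exact hgf'
  obtain ⟨p, hp⟩ := exists_pow_mul_mem_of_mem_affineIdeal D.homogeneous D.isHomogeneous hP hPJ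
  obtain ⟨m, hm⟩ := D.exists_X_pow_mul_mem hp i
  refine mem_sections_of_mul_mem (Submodule.sub_mem _ (D.glue_mem_sections_top q g i) (hs.1 i))
    (k := m + k + (D.N + 1) * e)
    (f := X i ^ m * (X i ^ k * (l ^ q * g * D.inv i ^ e) - X i ^ ((D.N + 1) * e) * f i)) ?_ ?_
  · rw [← Ideal.Quotient.eq_zero_iff_mem] at hm ⊢
    simp only [map_sub, map_mul, map_pow, D.mk_X_pow] at hm ⊢
    linear_combination Ideal.Quotient.mk J (D.inv i) ^ e * hm
  · change _ * toFrac K n (X i) ^ _ = _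
    rw [map_mul, map_sub, map_mul, map_mul _ _ (f i), ← D.glue_apply_mul q hg, ← hsf]
    simp only [map_pow, pow_add]
    ring

end InvertibleForm

end Gluing

section FormsOnSubscheme

theorem length_quotient_submoduleOf_eq {R M N : Type*} [Ring R] [AddCommGroup M] [Module R M]
    [AddCommGroup N] [Module R N] (φ : M →ₗ[R] N) {P Q : Submodule R N} (hφ : ∀ x, φ x ∈ P)
    (hP : ∀ y ∈ P, ∃ x, φ x - y ∈ Q) :
    Module.length R (P ⧸ Q.submoduleOf P) = Module.length R (M ⧸ Q.comap φ) := by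
  let ψ : M →ₗ[R] P ⧸ Q.submoduleOf P := (Q.submoduleOf P).mkQ ∘ₗ φ.codRestrict P hφ
  have hker : LinearMap.ker ψ = Q.comap φ := by
    ext x
    exact LinearMap.mem_ker.trans (Submodule.Quotient.mk_eq_zero _)
  have hψ : Function.Surjective ψ := by
    intro y
    obtain ⟨⟨y, hy⟩, rfl⟩ := Submodule.Quotient.mk_surjective _ y
    obtain ⟨x, hx⟩ := hP y hy
    exact ⟨x, (Submodule.Quotient.eq _).mpr hx⟩
  rw [← hker]
  exact (ψ.quotKerEquivOfSurjective hψ).length_eq.symm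

variable {K : Type*} [Field K] {n : ℕ}

theorem mem_quotientTrivial {J : Ideal (CoordRing K n)} {s : Fin (n + 1) → Frac K n} :
    s ∈ quotientTrivial J ↔ ∀ i, s i ∈ sections J 0 (chart i) := by
  simp only [quotientTrivial, Submodule.mem_pi, Set.mem_univ, forall_const]

/-- The Čech differential from `0`-cochains to `1`-cochains. -/
def differential (K : Type*) [Field K] (n : ℕ) :
    (Fin (n + 1) → Frac K n) →ₗ[K] (Fin (n + 1) → Fin (n + 1) → Frac K n) where
  toFun b i j := b j - b i
  map_add' b c := by
    ext i j
    exact add_sub_add_comm _ _ _ _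
  map_smul' c b := by
    ext i j
    exact (smul_sub c _ _).symm

theorem differential_apply (b : Fin (n + 1) → Frac K n) (i j : Fin (n + 1)) :
    differential K n b i j = b j - b i :=
  rfl

namespace InvertibleForm

variable {J : Ideal (CoordRing K n)} {l : CoordRing K n} (D : InvertibleForm J l)

include D in
theorem length_eq : length J = Module.length K (CoordRing K n ⧸ affineIdeal J l) := by
  have hcomap : (quotientTrivial J).comap (D.glue 0) = (affineIdeal J l).restrictScalars K := by
    ext f
    rw [Submodule.mem_comap, mem_quotientTrivial, D.forall_glue_mem_sections_iff]
    rfl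
  calc length J = Module.length K (CoordRing K n ⧸ (quotientTrivial J).comap (D.glue 0)) :=
        length_quotient_submoduleOf_eq _ (D.glue_mem_twistedCocycles 0) fun s hs => by
          simpa only [mem_quotientTrivial, Pi.sub_apply] using D.exists_glue_sub_mem 0 hs
    _ = Module.length K (CoordRing K n ⧸ affineIdeal J l) := by
        rw [hcomap]
        exact (Submodule.Quotient.restrictScalarsEquiv K (affineIdeal J l)).length_eq

theorem glue_sub_mem (q : ℕ) {f : CoordRing K n} (hf : f.IsHomogeneous q) (i : Fin (n + 1)) :
    D.glue q f i - toFrac K n f ∈ sections J q (chart i) := by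
  refine mem_sections_of_mul_mem (Submodule.sub_mem _ (D.glue_mem_sections_top q f i)
    (mem_sections_chart.mpr ⟨0, f, trivial, hf, by rw [pow_zero, mul_one]⟩))
    (k := (D.N + 1) * q) (f := l ^ q * f * D.inv i ^ q - f * X i ^ ((D.N + 1) * q)) ?_ ?_
  · rw [← Ideal.Quotient.eq_zero_iff_mem]
    simp only [map_sub, map_mul, map_pow, D.mk_X_pow]
    ring
  · change _ * toFrac K n (X i) ^ _ = _
    rw [sub_mul, D.glue_apply_mul q hf, map_sub, map_mul _ f, map_pow]

theorem differential_glue_mem_cocycles (q : ℕ) (f : CoordRing K n) :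
    differential K n (D.glue q f) ∈ cocycles J q :=
  ⟨(D.glue_mem_twistedCocycles q f).2, fun i j k => by
    simp only [differential_apply, add_comm (_ - D.glue q f i), sub_add_sub_cancel]⟩

theorem exists_form_sub_mem_affineIdeal (hn : 1 ≤ n) {q : ℕ} {f : CoordRing K n}
    (hf : differential K n (D.glue q f) ∈ coboundaries J q) :
    ∃ g : CoordRing K n, g.IsHomogeneous q ∧ f - g ∈ affineIdeal J l := by
  obtain ⟨b, hb, hfb⟩ := hf
  have hconst : ∀ i, D.glue q f i - b i = D.glue q f 0 - b 0 := fun i => by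
    have h0i := hfb 0 i
    rw [differential_apply] at h0i
    linear_combination h0i
  obtain ⟨g, hg, hgz⟩ := exists_form_of_forall_mem_sections hn
    (q := q) (z := D.glue q f 0 - b 0) fun i => hconst i ▸
      Submodule.sub_mem _ (D.glue_mem_sections_top q f i) (sections_le_top J q _ (hb i))
  refine ⟨g, hg, (D.forall_glue_mem_sections_iff q).mp fun i => ?_⟩
  have hsub := Submodule.sub_mem _ (hb i) (D.glue_sub_mem q hg i)
  rw [← hgz, ← hconst i] at hsub
  rw [map_sub, Pi.sub_apply]
  convert hsub using 1
  ring

theorem differential_glue_mem_coboundaries_iff (hn : 1 ≤ n) {q : ℕ} {f : CoordRing K n} :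
    differential K n (D.glue q f) ∈ coboundaries J q ↔
      f ∈ (affineIdeal J l).restrictScalars K ⊔ homogeneousSubmodule (Fin (n + 1)) K q := by
  constructor
  · intro hf
    obtain ⟨g, hg, hfg⟩ := D.exists_form_sub_mem_affineIdeal hn hf
    rw [← sub_add_cancel f g]
    exact Submodule.add_mem_sup hfg hg
  · intro hf
    obtain ⟨g, hg, h, hh, rfl⟩ := Submodule.mem_sup.mp hf
    refine ⟨fun i => D.glue q g i + (D.glue q h i - toFrac K n h), fun i =>
      Submodule.add_mem _ (D.glue_mem_sections_of_mem q hg i) (D.glue_sub_mem q hh i),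
      fun i j => ?_⟩
    rw [differential_apply, map_add, Pi.add_apply, Pi.add_apply]
    ring

theorem exists_differential_glue_sub_mem_coboundaries (hn : 1 ≤ n) {q : ℕ}
    {c : Fin (n + 1) → Fin (n + 1) → Frac K n} (hc : c ∈ cocycles J q) :
    ∃ f, differential K n (D.glue q f) - c ∈ coboundaries J q := by
  obtain ⟨b, hb, hcb⟩ := exists_eq_sub_of_cocycle hn
    (fun i j => sections_le_top J q _ (hc.1 i j)) hc.2
  obtain ⟨f, hf⟩ := D.exists_glue_sub_mem q (s := b) ⟨hb, fun i j => hcb i j ▸ hc.1 i j⟩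
  refine ⟨f, fun i => D.glue q f i - b i, hf, fun i j => ?_⟩
  rw [Pi.sub_apply, Pi.sub_apply, differential_apply, hcb]
  ring

include D in
theorem h1_eq (hn : 1 ≤ n) (q : ℕ) :
    h1 J q = Module.length K (CoordRing K n ⧸
      ((affineIdeal J l).restrictScalars K ⊔ homogeneousSubmodule (Fin (n + 1)) K q)) := by
  have hcomap : (coboundaries J q).comap (differential K n ∘ₗ D.glue q) =
      (affineIdeal J l).restrictScalars K ⊔ homogeneousSubmodule (Fin (n + 1)) K q :=
    Submodule.ext fun _ => D.differential_glue_mem_coboundaries_iff hn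
  rw [← hcomap]
  exact length_quotient_submoduleOf_eq _ (D.differential_glue_mem_cocycles q) fun _ hc =>
    D.exists_differential_glue_sub_mem_coboundaries hn hc

end InvertibleForm

end FormsOnSubscheme

section AvoidingHyperplane

variable {K : Type*} [Field K] {n : ℕ}

/-- The homogenization of a polynomial in one variable to a form in `x_j` and `x_i`. -/
def binaryHomogenization (i j : Fin (n + 1)) (P : Polynomial K) : CoordRing K n :=
  ∑ m ∈ Finset.range (P.natDegree + 1), C (P.coeff m) * (X j ^ m * X i ^ (P.natDegree - m))

theorem binaryHomogenization_isHomogeneous (i j : Fin (n + 1)) (P : Polynomial K) :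
    (binaryHomogenization i j P).IsHomogeneous P.natDegree := by
  refine IsHomogeneous.sum _ _ _ fun m hm => ?_
  have hmul := ((isHomogeneous_X_pow (R := K) j m).mul
    (isHomogeneous_X_pow i (P.natDegree - m))).C_mul (P.coeff m)
  rwa [Nat.add_sub_cancel' (Finset.mem_range_succ_iff.mp hm)] at hmul

theorem aeval_div_mul_X_pow (i j : Fin (n + 1)) (P : Polynomial K) :
    Polynomial.aeval (toFrac K n (X j) / toFrac K n (X i)) P *
      toFrac K n (X i) ^ P.natDegree = toFrac K n (binaryHomogenization i j P) := by
  rw [binaryHomogenization, Polynomial.aeval_eq_sum_range, Finset.sum_mul, map_sum]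
  refine Finset.sum_congr rfl fun m hm => ?_
  have hX := pow_ne_zero m (toFrac_X_ne_zero (K := K) i)
  rw [← Nat.add_sub_cancel' (Finset.mem_range_succ_iff.mp hm), Nat.add_sub_cancel_left, pow_add,
    map_mul, map_mul, map_pow, map_pow, ← MvPolynomial.algebraMap_eq, AlgHom.commutes,
    Algebra.smul_def, div_pow]
  field_simp

theorem eval_binaryHomogenization {i : Fin (n + 1)} (j : Fin (n + 1)) (P : Polynomial K)
    {x : Fin (n + 1) → K} (hx : x i = 1) : eval x (binaryHomogenization i j P) = P.eval (x j) := by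
  simp only [binaryHomogenization, map_mul, map_sum, map_pow, eval_X, eval_C, hx, one_pow, mul_one,
    Polynomial.eval_eq_sum_range]

theorem aeval_div_mem_sections (i j : Fin (n + 1)) (P : Polynomial K) :
    Polynomial.aeval (toFrac K n (X j) / toFrac K n (X i)) P ∈
      sections (⊤ : Ideal (CoordRing K n)) 0 (chart i) :=
  mem_sections_chart.mpr ⟨P.natDegree, _, trivial,
    (zero_add P.natDegree).symm ▸ binaryHomogenization_isHomogeneous i j P,
    aeval_div_mul_X_pow i j P⟩

theorem ClosedSubscheme.IsFinite.exists_aeval_div_mem_sections {Γ : ClosedSubscheme K n}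
    (hΓ : Γ.IsFinite) (i j : Fin (n + 1)) :
    ∃ P : Polynomial K, P ≠ 0 ∧
      Polynomial.aeval (toFrac K n (X j) / toFrac K n (X i)) P ∈
        sections Γ.ideal 0 (chart i) := by
  have := hΓ i
  let φ : Polynomial K →ₗ[K] (sections (⊤ : Ideal (CoordRing K n)) 0 (chart i) ⧸
      (sections Γ.ideal 0 (chart i)).submoduleOf (sections ⊤ 0 (chart i))) :=
    Submodule.mkQ _ ∘ₗ (Polynomial.aeval _).toLinearMap.codRestrict _ (aeval_div_mem_sections i j)
  have hφ : ¬ Function.Injective φ := fun h =>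
    Polynomial.not_finite (R := K) (Module.Finite.of_injective φ h)
  rw [← LinearMap.ker_eq_bot, ← Ne, Submodule.ne_bot_iff] at hφ
  obtain ⟨P, hP, hP0⟩ := hφ
  exact ⟨P, hP0, (Submodule.Quotient.mk_eq_zero
    ((sections Γ.ideal 0 (chart i)).submoduleOf (sections ⊤ 0 (chart i)))).mp
      (LinearMap.mem_ker.mp hP)⟩

theorem ClosedSubscheme.IsFinite.exists_polynomial_isRoot {Γ : ClosedSubscheme K n}
    (hΓ : Γ.IsFinite) (i j : Fin (n + 1)) :
    ∃ P : Polynomial K, P ≠ 0 ∧ ∀ x : Fin (n + 1) → K, x i = 1 →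
      (∀ f ∈ Γ.ideal, eval x f = 0) → P.IsRoot (x j) := by
  obtain ⟨P, hP0, hP⟩ := hΓ.exists_aeval_div_mem_sections i j
  refine ⟨P, hP0, fun x hxi hx => ?_⟩
  obtain ⟨k, f, hf, -, hPf⟩ := mem_sections_chart.mp hP
  have hform : binaryHomogenization i j P * X i ^ k = f * X i ^ P.natDegree := by
    apply toFrac_injective
    rw [map_mul, map_mul, ← aeval_div_mul_X_pow, ← hPf, map_pow, map_pow]
    ring
  have heval := congrArg (eval x) hform
  rwa [map_mul, map_mul, map_pow, map_pow, eval_X, hxi, one_pow, one_pow, mul_one, mul_one, hx f hf,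
    eval_binaryHomogenization j P hxi] at heval

theorem ClosedSubscheme.IsFinite.finite_chart {Γ : ClosedSubscheme K n} (hΓ : Γ.IsFinite)
    (i : Fin (n + 1)) :
    {x : Fin (n + 1) → K | x i = 1 ∧ ∀ f ∈ Γ.ideal, eval x f = 0}.Finite := by
  choose P hP0 hP using hΓ.exists_polynomial_isRoot i
  refine (Set.Finite.pi' fun j => Polynomial.finite_setOfPred_isRoot (hP0 j)).subset ?_
  rintro x ⟨hxi, hx⟩ j
  exact hP j x hxi hx

theorem exists_linear_form_ne_zero [Infinite K] {σ : Type*} [Finite σ] {s : Set (σ → K)}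
    (hs : s.Finite) (h0 : ∀ x ∈ s, x ≠ 0) :
    ∃ l : MvPolynomial σ K, l.IsHomogeneous 1 ∧ ∀ x ∈ s, eval x l ≠ 0 := by
  classical
  cases nonempty_fintype σ
  let H : (σ → K) → Submodule K (σ → K) := fun x =>
    LinearMap.ker (Fintype.linearCombination K x)
  have mem_H : ∀ x c, c ∈ H x ↔ ∑ j, c j * x j = 0 := fun x c => by
    simp only [H, LinearMap.mem_ker, Fintype.linearCombination_apply, smul_eq_mul]
  have htop : (⊤ : Subspace K (σ → K)) ∉ hs.toFinset.image H := by
    rw [Finset.mem_image]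
    rintro ⟨x, hx, hHx⟩
    refine h0 x (hs.mem_toFinset.mp hx) (funext fun j => ?_)
    have hsingle : Pi.single j 1 ∈ H x := hHx ▸ Submodule.mem_top
    simpa [mem_H, Pi.single_apply] using hsingle
  obtain ⟨c, hc⟩ := (Set.ne_univ_iff_exists_notMem _).mp
    (Subspace.biUnion_ne_univ_of_top_notMem htop)
  refine ⟨∑ j, C (c j) * X j, ?_, fun x hx hlx => hc ?_⟩
  · exact IsHomogeneous.sum _ _ _ fun j _ => (isHomogeneous_X K j).C_mul (c j)
  · refine Set.mem_iUnion₂.mpr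
      ⟨H x, Finset.mem_image_of_mem _ (hs.mem_toFinset.mpr hx), (mem_H x c).mpr ?_⟩
    simpa using hlx

theorem ClosedSubscheme.eval_smul_eq_zero (Γ : ClosedSubscheme K n) {x : Fin (n + 1) → K}
    (hx : ∀ f ∈ Γ.ideal, eval x f = 0) (c : K) : ∀ f ∈ Γ.ideal, eval (c • x) f = 0 := by
  intro f hf
  rw [← sum_homogeneousComponent f, map_sum]
  refine Finset.sum_eq_zero fun i _ => ?_
  rw [eval_smul_of_isHomogeneous (homogeneousComponent_isHomogeneous i f),
    hx _ (Γ.homogeneous f hf i), mul_zero]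

theorem ClosedSubscheme.IsFinite.exists_invertibleForm [IsAlgClosed K] {Γ : ClosedSubscheme K n}
    (hΓ : Γ.IsFinite) : ∃ l, Nonempty (InvertibleForm Γ.ideal l) := by
  have : Infinite K := IsAlgClosed.instInfinite
  have ne_zero : ∀ x ∈ ⋃ i, {x : Fin (n + 1) → K | x i = 1 ∧ ∀ f ∈ Γ.ideal, eval x f = 0},
      x ≠ 0 := by
    rintro _ hx rfl
    obtain ⟨i, hi, -⟩ := Set.mem_iUnion.mp hx
    exact zero_ne_one hi
  obtain ⟨l, hl, hl0⟩ := exists_linear_form_ne_zero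
    (Set.finite_iUnion fun i => hΓ.finite_chart i) ne_zero
  refine ⟨l, nonempty_invertibleForm Γ.homogeneous hl fun i => ?_⟩
  change X i ∈ (Γ.ideal ⊔ Ideal.span {l}).radical
  rw [← vanishingIdeal_zeroLocus_eq_radical (K := K)]
  intro x hx
  rw [aeval_X]
  by_contra hxi
  have hxΓ : ∀ f ∈ Γ.ideal, eval x f = 0 := fun f hf => by
    simpa using hx f (Ideal.mem_sup_left hf)
  have hxl : eval x l = 0 := by
    simpa using hx l (Ideal.mem_sup_right (Ideal.mem_span_singleton_self l))
  refine hl0 ((x i)⁻¹ • x) (Set.mem_iUnion.mpr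
    ⟨i, inv_mul_cancel₀ hxi, Γ.eval_smul_eq_zero hxΓ _⟩) ?_
  rw [eval_smul_of_isHomogeneous hl, hxl, mul_zero]

end AvoidingHyperplane

section AffineModel

variable {K : Type*} [Field K] {n : ℕ}

/-- The coordinate ring of the affine part `l = 1` of the cone defined by `J`. -/
abbrev AffineRing (J : Ideal (CoordRing K n)) (l : CoordRing K n) : Type _ :=
  CoordRing K n ⧸ affineIdeal J l

/-- The restriction of polynomials to the affine part `l = 1` of the cone defined by `J`. -/
abbrev toAffine (J : Ideal (CoordRing K n)) (l : CoordRing K n) :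
    CoordRing K n →ₐ[K] AffineRing J l :=
  Ideal.Quotient.mkₐ K (affineIdeal J l)

/-- The restrictions of the linear forms to the affine part `l = 1`. -/
abbrev linearForms (J : Ideal (CoordRing K n)) (l : CoordRing K n) :
    Submodule K (AffineRing J l) :=
  (homogeneousSubmodule (Fin (n + 1)) K 1).map (toAffine J l).toLinearMap

instance finite_homogeneousSubmodule {σ : Type*} [Finite σ] (k : ℕ) :
    Module.Finite K (homogeneousSubmodule σ K k) :=
  Module.Finite.iff_fg.mpr (homogeneousSubmodule_fg _ _ _)

theorem finrank_homogeneousSubmodule_one {σ : Type*} [Fintype σ] :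
    finrank K (homogeneousSubmodule σ K 1) = Fintype.card σ := by
  rw [homogeneousSubmodule_one_eq_span_X, finrank_span_eq_card (linearIndependent_X _ _)]

theorem linearForms_pow (J : Ideal (CoordRing K n)) (l : CoordRing K n) (k : ℕ) :
    linearForms J l ^ k =
      (homogeneousSubmodule (Fin (n + 1)) K k).map (toAffine J l).toLinearMap := by
  rw [linearForms, ← Submodule.map_pow, homogeneousSubmodule_one_pow]

theorem linearForms_eq_span (J : Ideal (CoordRing K n)) (l : CoordRing K n) :
    linearForms J l = Submodule.span K (Set.range fun j => toAffine J l (X j)) := by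
  rw [linearForms, homogeneousSubmodule_one_eq_span_X, Submodule.map_span, ← Set.range_comp]
  rfl

section FinrankMap

variable {M M₁ M₂ : Type*} [AddCommGroup M] [Module K M] [AddCommGroup M₁] [Module K M₁]
  [AddCommGroup M₂] [Module K M₂]

theorem finrank_map_le_of_forall_imp (f : M →ₗ[K] M₁) (g : M →ₗ[K] M₂) (U : Submodule K M)
    [Module.Finite K U] (hfg : ∀ x ∈ U, f x = 0 → g x = 0) :
    finrank K (U.map g) ≤ finrank K (U.map f) := by
  have hf := finrank_map_add_finrank_inf_ker f U
  have hg := finrank_map_add_finrank_inf_ker g U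
  have hker : U ⊓ LinearMap.ker f ≤ U ⊓ LinearMap.ker g := fun x hx =>
    ⟨hx.1, hfg x hx.1 hx.2⟩
  have : Module.Finite K (U ⊓ LinearMap.ker g : Submodule K M) :=
    Submodule.finiteDimensional_of_le inf_le_left
  have := Submodule.finrank_mono hker
  omega

theorem finrank_map_eq_of_forall_iff (f : M →ₗ[K] M₁) (g : M →ₗ[K] M₂) (U : Submodule K M)
    [Module.Finite K U] (hfg : ∀ x ∈ U, f x = 0 ↔ g x = 0) :
    finrank K (U.map f) = finrank K (U.map g) :=
  le_antisymm (finrank_map_le_of_forall_imp g f U fun x hx => (hfg x hx).mpr)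
    (finrank_map_le_of_forall_imp f g U fun x hx => (hfg x hx).mp)

end FinrankMap

section SpanForms

variable {J : Ideal (CoordRing K n)} {l : CoordRing K n} {L : Submodule K (CoordRing K n)}

theorem homogeneousComponent_mem_sup_span (hJ : ∀ f ∈ J, ∀ m : ℕ, homogeneousComponent m f ∈ J)
    {e : ℕ} (hL : L ≤ homogeneousSubmodule (Fin (n + 1)) K e) :
    ∀ f ∈ J ⊔ Ideal.span (L : Set (CoordRing K n)), ∀ m : ℕ,
      homogeneousComponent m f ∈ J ⊔ Ideal.span (L : Set (CoordRing K n)) := by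
  intro f hf m
  obtain ⟨a, ha, b, hb, rfl⟩ := Submodule.mem_sup.mp hf
  rw [map_add]
  refine Submodule.add_mem_sup (hJ a ha m) ?_
  let _ := MvPolynomial.gradedAlgebra (σ := Fin (n + 1)) (R := K)
  exact homogeneousComponent_mem_of_mem
    (Ideal.homogeneous_span _ _ fun x hx => ⟨e, hL hx⟩) hb m

/-- The ideal generated in the affine part `l = 1` by a space of forms. -/
abbrev affineSpan (J : Ideal (CoordRing K n)) (l : CoordRing K n)
    (L : Submodule K (CoordRing K n)) : Ideal (AffineRing J l) :=
  Ideal.span (L.map (toAffine J l).toLinearMap : Submodule K (AffineRing J l))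

theorem InvertibleForm.length_sup_span (D : InvertibleForm J l) {e : ℕ}
    (hL : L ≤ homogeneousSubmodule (Fin (n + 1)) K e) :
    length (J ⊔ Ideal.span (L : Set (CoordRing K n))) =
      Module.length K (AffineRing J l ⧸ affineSpan J l L) := by
  let E : InvertibleForm (J ⊔ Ideal.span (L : Set (CoordRing K n))) l :=
    ⟨homogeneousComponent_mem_sup_span D.homogeneous hL, D.isHomogeneous, D.N, D.inv,
      D.isHomogeneous_inv, fun i => Ideal.mem_sup_left (D.sub_mem i)⟩
  have hspan : affineSpan J l L =
      (Ideal.span (L : Set (CoordRing K n))).map (toAffine J l) := by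
    rw [Ideal.map_span]
    rfl
  have hsup : affineIdeal (J ⊔ Ideal.span (L : Set (CoordRing K n))) l =
      affineIdeal J l ⊔ Ideal.span (L : Set (CoordRing K n)) := sup_right_comm _ _ _
  rw [E.length_eq, hspan, hsup]
  exact (DoubleQuot.quotQuotEquivQuotSupₐ K (affineIdeal J l)
    (Ideal.span (L : Set (CoordRing K n)))).toLinearEquiv.length_eq.symm

end SpanForms

namespace ClosedSubscheme

variable {Γ : ClosedSubscheme K n} {l : CoordRing K n}

theorem mem_ideal_iff (D : InvertibleForm Γ.ideal l) {f : CoordRing K n} {k : ℕ}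
    (hf : f.IsHomogeneous k) : f ∈ Γ.ideal ↔ toAffine Γ.ideal l f = 0 := by
  rw [Ideal.Quotient.mkₐ_eq_mk, Ideal.Quotient.eq_zero_iff_mem]
  refine ⟨Ideal.mem_sup_left, fun hfJ => ?_⟩
  obtain ⟨m, hm⟩ := exists_pow_mul_mem_of_mem_affineIdeal Γ.homogeneous D.isHomogeneous hf hfJ
  exact Γ.saturated f fun i => D.exists_X_pow_mul_mem hm i

theorem hilbertFunction_eq (D : InvertibleForm Γ.ideal l) (k : ℕ) :
    hilbertFunction Γ.ideal k = finrank K ↥(linearForms Γ.ideal l ^ k) := by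
  rw [linearForms_pow, hilbertFunction]
  refine finrank_map_eq_of_forall_iff _ _ _ fun f hf => ?_
  rw [AlgHom.toLinearMap_apply, AlgHom.toLinearMap_apply, ← mem_ideal_iff D hf,
    Ideal.Quotient.mkₐ_eq_mk, Ideal.Quotient.eq_zero_iff_mem]

theorem finite_affineRing (D : InvertibleForm Γ.ideal l) {d : ℕ} (hd : Γ.degree = d) :
    Module.Finite K (AffineRing Γ.ideal l) := by
  rw [degree, D.length_eq] at hd
  have hlength : IsFiniteLength K (AffineRing Γ.ideal l) :=
    Module.length_ne_top_iff.mp (by rw [hd]; exact ENat.natCast_ne_top d)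
  have := (isFiniteLength_iff_isNoetherian_isArtinian.mp hlength).1
  infer_instance

theorem degree_eq_finrank (D : InvertibleForm Γ.ideal l) [Module.Finite K (AffineRing Γ.ideal l)] :
    Γ.degree = finrank K (AffineRing Γ.ideal l) := by
  rw [degree, D.length_eq, Module.length_eq_finrank]

theorem h1_eq_length_quotient (hn : 1 ≤ n) (D : InvertibleForm Γ.ideal l) (q : ℕ) :
    h1 Γ.ideal q = Module.length K (AffineRing Γ.ideal l ⧸ linearForms Γ.ideal l ^ q) := by
  let ψ : CoordRing K n →ₗ[K] (AffineRing Γ.ideal l ⧸ linearForms Γ.ideal l ^ q) :=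
    (linearForms Γ.ideal l ^ q).mkQ ∘ₗ (toAffine Γ.ideal l).toLinearMap
  have hψ : Function.Surjective ψ :=
    (Submodule.mkQ_surjective _).comp (Ideal.Quotient.mkₐ_surjective K _)
  have hker : LinearMap.ker ψ = (affineIdeal Γ.ideal l).restrictScalars K ⊔
      homogeneousSubmodule (Fin (n + 1)) K q := by
    rw [LinearMap.ker_comp, Submodule.ker_mkQ, linearForms_pow, Submodule.comap_map_eq, sup_comm]
    congr 1
    ext f
    exact Ideal.Quotient.eq_zero_iff_mem
  rw [D.h1_eq hn, ← hker]
  exact (ψ.quotKerEquivOfSurjective hψ).length_eq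

theorem h1_add_hilbertFunction (hn : 1 ≤ n) (D : InvertibleForm Γ.ideal l) (q : ℕ) :
    h1 Γ.ideal q + hilbertFunction Γ.ideal q = Γ.degree := by
  have hfin : Module.Finite K ↥(linearForms Γ.ideal l ^ q) := by
    rw [linearForms_pow]
    infer_instance
  rw [h1_eq_length_quotient hn D, hilbertFunction_eq D, ← Module.length_eq_finrank, add_comm,
    degree, D.length_eq]
  exact (Module.length_eq_add_of_exact _ _ (Submodule.subtype_injective _)
    (Submodule.mkQ_surjective (linearForms Γ.ideal l ^ q)) (LinearMap.exact_subtype_mkQ _)).symm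

namespace IsInLinearlyGeneralPosition

theorem add_two_le_degree (hΓ : Γ.IsInLinearlyGeneralPosition) :
    ((n + 2 : ℕ) : ℕ∞) ≤ Γ.degree := by
  obtain ⟨L, hL, hLn, hlength⟩ := hΓ.1
  have : Module.Finite K L := Submodule.finiteDimensional_of_le hL
  obtain rfl : L = ⊥ := Submodule.finrank_eq_zero.mp (by omega)
  rwa [Submodule.bot_coe, Ideal.span_singleton_zero, sup_bot_eq] at hlength

variable [Module.Finite K (AffineRing Γ.ideal l)]

theorem finrank_quotient_add_finrank_le (hΓ : Γ.IsInLinearlyGeneralPosition)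
    (D : InvertibleForm Γ.ideal l) {L : Submodule K (CoordRing K n)}
    (hL : L ≤ homogeneousSubmodule (Fin (n + 1)) K 1) (hL1 : 1 ≤ finrank K L)
    (hLn : finrank K L ≤ n) :
    finrank K (AffineRing Γ.ideal l ⧸ affineSpan Γ.ideal l L) + finrank K L ≤ n + 1 := by
  by_contra! hlt
  have hsecant : Γ.HasSecantPlane (n - finrank K L) := by
    refine ⟨L, hL, by omega, ?_⟩
    rw [D.length_sup_span hL, Module.length_eq_finrank]
    exact_mod_cast (by omega)
  have := hΓ.2 hsecant
  omega

theorem disjoint_ker_toAffine (hΓ : Γ.IsInLinearlyGeneralPosition) (hn : 1 ≤ n)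
    (D : InvertibleForm Γ.ideal l) :
    Disjoint (homogeneousSubmodule (Fin (n + 1)) K 1)
      (LinearMap.ker (toAffine Γ.ideal l).toLinearMap) := by
  rw [Submodule.disjoint_def]
  intro f hf hfker
  by_contra hf0
  have hbound := hΓ.finrank_quotient_add_finrank_le D (L := K ∙ f)
    ((Submodule.span_singleton_le_iff_mem _ _).mpr hf)
    (finrank_span_singleton hf0).ge ((finrank_span_singleton hf0).le.trans hn)
  have hspan : affineSpan Γ.ideal l (K ∙ f) = ⊥ := by
    rw [affineSpan, Submodule.map_span, Set.image_singleton, LinearMap.mem_ker.mp hfker,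
      Submodule.span_zero_singleton, Submodule.bot_coe, Ideal.span_singleton_zero]
  have hquot := finrank_quotient_add_finrank_restrictScalars (K := K)
    (⊥ : Ideal (AffineRing Γ.ideal l))
  rw [Submodule.restrictScalars_bot, finrank_bot] at hquot
  rw [finrank_span_singleton hf0, hspan] at hbound
  have hdeg := hΓ.add_two_le_degree
  rw [degree_eq_finrank D, Nat.cast_le] at hdeg
  omega

theorem finrank_map_toAffine (hΓ : Γ.IsInLinearlyGeneralPosition) (hn : 1 ≤ n)
    (D : InvertibleForm Γ.ideal l) {L : Submodule K (CoordRing K n)}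
    (hL : L ≤ homogeneousSubmodule (Fin (n + 1)) K 1) :
    finrank K (L.map (toAffine Γ.ideal l).toLinearMap) = finrank K L := by
  have : Module.Finite K L := Submodule.finiteDimensional_of_le hL
  have hadd := finrank_map_add_finrank_inf_ker (toAffine Γ.ideal l).toLinearMap L
  rwa [((hΓ.disjoint_ker_toAffine hn D).mono_left hL).eq_bot, finrank_bot, add_zero] at hadd

theorem isLinearlyGeneral (hΓ : Γ.IsInLinearlyGeneralPosition) (hn : 1 ≤ n)
    (D : InvertibleForm Γ.ideal l) : IsLinearlyGeneral n (linearForms Γ.ideal l) := by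
  have hforms : finrank K (homogeneousSubmodule (Fin (n + 1)) K 1) = n + 1 := by
    rw [finrank_homogeneousSubmodule_one, Fintype.card_fin]
  have one_mem : (1 : AffineRing Γ.ideal l) ∈ linearForms Γ.ideal l :=
    ⟨l, D.isHomogeneous, mk_affineIdeal_self _ _⟩
  refine ⟨one_mem, (hΓ.finrank_map_toAffine hn D le_rfl).trans hforms, fun W hW hW0 => ?_⟩
  obtain ⟨L, hL, rfl⟩ : ∃ L ≤ homogeneousSubmodule (Fin (n + 1)) K 1,
      L.map (toAffine Γ.ideal l).toLinearMap = W := by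
    refine ⟨homogeneousSubmodule (Fin (n + 1)) K 1 ⊓ W.comap (toAffine Γ.ideal l).toLinearMap,
      inf_le_left, ?_⟩
    rw [← Submodule.map_inf_eq_map_inf_comap, inf_eq_right.mpr hW]
  rw [hΓ.finrank_map_toAffine hn D hL]
  by_cases hLn : finrank K L ≤ n
  · refine hΓ.finrank_quotient_add_finrank_le D hL ?_ hLn
    rwa [← hΓ.finrank_map_toAffine hn D hL, Nat.one_le_iff_ne_zero, Ne, Submodule.finrank_eq_zero]
  · have hLtop : L = homogeneousSubmodule (Fin (n + 1)) K 1 :=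
      Submodule.eq_of_le_of_finrank_le hL (by omega)
    have hspan : affineSpan Γ.ideal l L = ⊤ :=
      (Ideal.eq_top_iff_one _).mpr (Ideal.subset_span (hLtop ▸ one_mem))
    have : Subsingleton (AffineRing Γ.ideal l ⧸ affineSpan Γ.ideal l L) :=
      Ideal.Quotient.subsingleton_iff.mpr hspan
    rw [Module.finrank_zero_of_subsingleton, hLtop, hforms, zero_add]

end IsInLinearlyGeneralPosition

end ClosedSubscheme

end AffineModel

section RationalNormalCurve

variable {K : Type*} [Field K] {n : ℕ}

theorem homogeneousComponent_mul_aeval {σ τ : Type*} {m : ℕ} (hm : 1 ≤ m)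
    {F : σ → MvPolynomial τ K} (hF : ∀ i, (F i).IsHomogeneous m) (f : MvPolynomial σ K) (k : ℕ) :
    homogeneousComponent (m * k) (aeval F f) = aeval F (homogeneousComponent k f) := by
  have component_aeval : ∀ i, homogeneousComponent (m * k) (aeval F (homogeneousComponent i f)) =
      if i = k then aeval F (homogeneousComponent k f) else 0 := by
    intro i
    rw [homogeneousComponent_of_mem ((homogeneousComponent_isHomogeneous i f).aeval F hF)]
    by_cases hik : i = k
    · simp [hik]
    · rw [if_neg fun h => hik (Nat.eq_of_mul_eq_mul_left hm h.symm), if_neg hik]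
  conv_lhs => rw [← sum_homogeneousComponent f, map_sum, map_sum]
  simp only [component_aeval, Finset.sum_ite_eq', Finset.mem_range]
  split_ifs with hk
  · rfl
  · rw [homogeneousComponent_eq_zero _ _ (by omega), map_zero]

/-- The closure of the image of the rational map given by forms of positive degree `m`, not all
zero, with its reduced structure. -/
def imageOfForms {σ : Type*} {m : ℕ} (hm : 1 ≤ m) (F : Fin (n + 1) → MvPolynomial σ K)
    (hF : ∀ i, (F i).IsHomogeneous m) (hF0 : F ≠ 0) : ClosedSubscheme K n where
  ideal := RingHom.ker (aeval F : CoordRing K n →ₐ[K] _)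
  homogeneous := by
    intro f hf k
    rw [RingHom.mem_ker] at hf ⊢
    rw [← homogeneousComponent_mul_aeval hm hF, hf, map_zero]
  saturated := by
    intro f hf
    obtain ⟨i, hi⟩ := Function.ne_iff.mp hF0
    obtain ⟨k, hk⟩ := hf i
    rw [RingHom.mem_ker, map_mul, map_pow, aeval_X] at hk
    exact (mul_eq_zero.mp hk).resolve_left (pow_ne_zero _ hi)

/-- The monomials `s ^ (n - i) * t ^ i` of degree `n` in two variables. -/
abbrev binaryMonomial (K : Type*) [Field K] (n : ℕ) (i : Fin (n + 1)) : MvPolynomial (Fin 2) K :=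
  X 0 ^ (n - i : ℕ) * X 1 ^ (i : ℕ)

theorem isHomogeneous_binaryMonomial (i : Fin (n + 1)) :
    (binaryMonomial K n i).IsHomogeneous n := by
  have hmul := (isHomogeneous_X_pow (R := K) (0 : Fin 2) (n - i)).mul
    (isHomogeneous_X_pow (1 : Fin 2) i)
  rwa [Nat.sub_add_cancel (Nat.lt_succ_iff.mp i.2)] at hmul

theorem linearIndependent_binaryMonomial : LinearIndependent K (binaryMonomial K n) := by
  let exponent : Fin (n + 1) → Fin 2 →₀ ℕ := fun i =>
    Finsupp.single 0 (n - i : ℕ) + Finsupp.single 1 (i : ℕ)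
  have exponent_injective : Function.Injective exponent := fun i j hij => by
    simpa [exponent, Fin.val_inj] using DFunLike.congr_fun hij 1
  have hmonomial : binaryMonomial K n = basisMonomials (Fin 2) K ∘ exponent := by
    funext i
    rw [binaryMonomial, X_pow_eq_monomial, X_pow_eq_monomial, monomial_mul, mul_one]
    rfl
  rw [hmonomial]
  exact (basisMonomials (Fin 2) K).linearIndependent.comp exponent exponent_injective

theorem homogeneousSubmodule_le_span_binaryMonomial (m : ℕ) :
    homogeneousSubmodule (Fin 2) K m ≤ Submodule.span K (Set.range (binaryMonomial K m)) := by
  intro f hf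
  rw [f.as_sum]
  refine Submodule.sum_mem _ fun d hd => ?_
  have hdm : d.degree = m := by
    by_contra h
    exact mem_support_iff.mp hd (IsHomogeneous.coeff_eq_zero hf h)
  rw [Finsupp.degree_eq_sum, Fin.sum_univ_two] at hdm
  have hmonomial : monomial d (coeff d f) = coeff d f • binaryMonomial K m ⟨d 1, by omega⟩ := by
    rw [monomial_eq, Finsupp.prod_fintype _ _ (fun i => pow_zero _), Fin.prod_univ_two,
      smul_eq_C_mul, binaryMonomial, show m - d 1 = d 0 by omega]
  rw [hmonomial]
  exact Submodule.smul_mem _ _ (Submodule.subset_span ⟨_, rfl⟩)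

theorem finrank_homogeneousSubmodule_two_le (m : ℕ) :
    finrank K (homogeneousSubmodule (Fin 2) K m) ≤ m + 1 := by
  have := FiniteDimensional.span_of_finite K (Set.finite_range (binaryMonomial K m))
  calc finrank K (homogeneousSubmodule (Fin 2) K m)
      ≤ finrank K (Submodule.span K (Set.range (binaryMonomial K m))) :=
        Submodule.finrank_mono (homogeneousSubmodule_le_span_binaryMonomial m)
    _ ≤ Fintype.card (Fin (m + 1)) := finrank_range_le_card _
    _ = m + 1 := Fintype.card_fin _

theorem ClosedSubscheme.IsRationalNormalCurve.hilbertFunction_le {C : ClosedSubscheme K n}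
    (hC : C.IsRationalNormalCurve) {J : Ideal (CoordRing K n)} (hJ : C.ideal ≤ J) (k : ℕ) :
    hilbertFunction J k ≤ n * k + 1 := by
  obtain ⟨F, hF, -, hCF⟩ := hC
  let substitution : CoordRing K n →ₐ[K] MvPolynomial (Fin 2) K := aeval F
  have vanishing : ∀ f ∈ homogeneousSubmodule (Fin (n + 1)) K k,
      substitution.toLinearMap f = 0 → (Ideal.Quotient.mkₐ K J).toLinearMap f = 0 :=
    fun f _ hf => Ideal.Quotient.eq_zero_iff_mem.mpr (hJ (hCF ▸ hf))
  have map_le : (homogeneousSubmodule (Fin (n + 1)) K k).map substitution.toLinearMap ≤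
      homogeneousSubmodule (Fin 2) K (n * k) := by
    rintro _ ⟨f, hf, rfl⟩
    exact IsHomogeneous.aeval hf F hF
  exact (finrank_map_le_of_forall_imp _ _ _ vanishing).trans
    ((Submodule.finrank_mono map_le).trans (finrank_homogeneousSubmodule_two_le (n * k)))

section Minors

variable {A : Type*} [CommRing A] {u : ℕ → A}

theorem isCoprime_of_minors (hu : ∀ i < n, ∀ j < n, u i * u (j + 1) = u (i + 1) * u j)
    (hspan : Ideal.span (Set.range fun i : Fin (n + 1) => u i) = ⊤) : IsCoprime (u 0) (u n) := by
  rw [← Ideal.isCoprime_span_singleton_iff, Ideal.isCoprime_iff_sup_eq, ← Ideal.span_insert]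
  by_contra hne
  obtain ⟨m, hm, hle⟩ := Ideal.exists_le_maximal _ hne
  have hu0 : u 0 ∈ m := hle (Ideal.subset_span (by simp))
  have hun : u n ∈ m := hle (Ideal.subset_span (by simp))
  have hui : ∀ i ≤ n, u i ∈ m := by
    intro i
    induction i with
    | zero => exact fun _ => hu0
    | succ i ih =>
      intro hi
      rcases hi.eq_or_lt with rfl | hlt
      · exact hun
      · have hsq : u (i + 1) * u (i + 1) ∈ m :=
          hu i (by omega) (i + 1) hlt ▸ m.mul_mem_right _ (ih (by omega))
        exact (hm.isPrime.mem_or_mem hsq).elim id id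
  refine hm.ne_top (top_le_iff.mp (hspan ▸ Ideal.span_le.mpr ?_))
  rintro _ ⟨i, rfl⟩
  exact hui i (by omega)

theorem map_eq_mul_pow_of_minors {B : Type*} [CommRing B]
    (hu : ∀ i < n, ∀ j < n, u i * u (j + 1) = u (i + 1) * u j) (ρ : A →+* B)
    {c : B} (hc : ρ (u 0) * c = 1) (i : ℕ) (hi : i ≤ n) :
    ρ (u i) = ρ (u 0) * (ρ (u 1) * c) ^ i := by
  induction i with
  | zero => simp
  | succ i ih =>
    have hminor := congrArg ρ (hu 0 (by omega) i (by omega))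
    rw [map_mul, map_mul, zero_add] at hminor
    rw [pow_succ, ← mul_assoc, ← ih (by omega)]
    linear_combination c * hminor - ρ (u (i + 1)) * hc

theorem map_eq_mul_pow_of_minors_last {B : Type*} [CommRing B]
    (hu : ∀ i < n, ∀ j < n, u i * u (j + 1) = u (i + 1) * u j) (ρ : A →+* B)
    {c : B} (hc : ρ (u n) * c = 1) (i : ℕ) (hi : i ≤ n) :
    ρ (u i) = ρ (u n) * (ρ (u (n - 1)) * c) ^ (n - i) := by
  have hrev := map_eq_mul_pow_of_minors (n := n) (u := fun i => u (n - i)) (fun i hi j hj => by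
    have hminor := hu (n - (i + 1)) (by omega) (n - (j + 1)) (by omega)
    rw [show n - (i + 1) + 1 = n - i by omega, show n - (j + 1) + 1 = n - j by omega] at hminor
    exact hminor.symm) ρ hc (n - i) (by omega)
  simpa [Nat.sub_sub_self hi] using hrev

end Minors

section Parametrization

variable {A : Type*} [CommRing A] [Algebra K A] {V : Submodule K A}
  (b : Basis (Fin (n + 1)) K V)

theorem map_aeval_eq_zero_of_parametrization {B : Type*} [CommRing B] [Algebra K B] (ρ : A →ₐ[K] B)
    {x : Fin (n + 1) → V} {c σ τ : B}
    (hb : ∀ i, ρ (b i) = c * (σ ^ (n - i : ℕ) * τ ^ (i : ℕ))) {f : CoordRing K n} {k : ℕ}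
    (hf : f.IsHomogeneous k)
    (hfF : aeval (fun j => b.constr K (binaryMonomial K n) (x j)) f = 0) :
    ρ (aeval (fun j => (x j : A)) f) = 0 := by
  let evalAt : MvPolynomial (Fin 2) K →ₐ[K] B := aeval ![σ, τ]
  have hlin : ρ.toLinearMap ∘ₗ V.subtype =
      LinearMap.mulLeft K c ∘ₗ evalAt.toLinearMap ∘ₗ b.constr K (binaryMonomial K n) := by
    refine b.ext fun i => ?_
    simp [hb, evalAt]
  have hx : ∀ j, ρ (x j) = c * evalAt (b.constr K (binaryMonomial K n) (x j)) := fun j =>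
    DFunLike.congr_fun hlin (x j)
  rw [← AlgHom.comp_apply, comp_aeval]
  simp only [hx]
  rw [aeval_mul_of_isHomogeneous hf, ← comp_aeval, AlgHom.comp_apply, hfF, map_zero, mul_zero]

theorem exists_pow_mul_aeval_eq_zero_of_parametrization {v : A} {σ τ : Localization.Away v}
    (hb : ∀ i, algebraMap A (Localization.Away v) (b i) =
      algebraMap A (Localization.Away v) v * (σ ^ (n - i : ℕ) * τ ^ (i : ℕ)))
    {x : Fin (n + 1) → V} {f : CoordRing K n} {k : ℕ} (hf : f.IsHomogeneous k)
    (hfF : aeval (fun j => b.constr K (binaryMonomial K n) (x j)) f = 0) :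
    ∃ m : ℕ, v ^ m * aeval (fun j => (x j : A)) f = 0 := by
  have hzero : algebraMap A (Localization.Away v) (aeval (fun j => (x j : A)) f) = 0 :=
    map_aeval_eq_zero_of_parametrization b (IsScalarTower.toAlgHom K A (Localization.Away v)) hb
      hf hfF
  rw [IsLocalization.map_eq_zero_iff (Submonoid.powers v)] at hzero
  obtain ⟨⟨_, m, rfl⟩, hm⟩ := hzero
  exact ⟨m, hm⟩

theorem aeval_eq_zero_of_minors (one_mem : 1 ∈ V) {u : ℕ → A}
    (hbu : ∀ i, (b i : A) = u i) (hu : ∀ i < n, ∀ j < n, u i * u (j + 1) = u (i + 1) * u j)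
    {x : Fin (n + 1) → V} {f : CoordRing K n} {k : ℕ} (hf : f.IsHomogeneous k)
    (hfF : aeval (fun j => b.constr K (binaryMonomial K n) (x j)) f = 0) :
    aeval (fun j => (x j : A)) f = 0 := by
  have span_eq : Submodule.span K (Set.range fun i : Fin (n + 1) => u i) = V := by
    rw [← V.range_subtype, LinearMap.range_eq_map, ← b.span_eq, Submodule.map_span,
      ← Set.range_comp]
    exact congrArg _ (congrArg _ (funext fun i => (hbu i).symm))
  have span_eq_top : Ideal.span (Set.range fun i : Fin (n + 1) => u i) = ⊤ :=
    (Ideal.eq_top_iff_one _).mpr (Submodule.span_le_restrictScalars K A _ (span_eq ▸ one_mem))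
  obtain ⟨m₀, hm₀⟩ := exists_pow_mul_aeval_eq_zero_of_parametrization b (v := u 0) (σ := 1)
    (τ := algebraMap A _ (u 1) * IsLocalization.Away.invSelf (u 0)) (fun i => by
      rw [hbu, one_pow, one_mul]
      exact map_eq_mul_pow_of_minors hu (algebraMap A _)
        (IsLocalization.Away.mul_invSelf (u 0)) i (by omega)) hf hfF
  obtain ⟨m₁, hm₁⟩ := exists_pow_mul_aeval_eq_zero_of_parametrization b (v := u n) (τ := 1)
    (σ := algebraMap A _ (u (n - 1)) * IsLocalization.Away.invSelf (u n)) (fun i => by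
      rw [hbu, one_pow, mul_one]
      exact map_eq_mul_pow_of_minors_last hu (algebraMap A _)
        (IsLocalization.Away.mul_invSelf (u n)) i (by omega)) hf hfF
  obtain ⟨p, p', hp⟩ := (isCoprime_of_minors hu span_eq_top).pow (m := m₀) (n := m₁)
  linear_combination (-aeval (fun j => (x j : A)) f) * hp + p * hm₀ + p' * hm₁

end Parametrization

namespace ClosedSubscheme

variable {Γ : ClosedSubscheme K n} {l : CoordRing K n}

theorem liesOnRationalNormalCurve_of_basis (hn : 1 ≤ n) (D : InvertibleForm Γ.ideal l)
    (hV : IsLinearlyGeneral n (linearForms Γ.ideal l))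
    (b : Basis (Fin (n + 1)) K (linearForms Γ.ideal l)) {u : ℕ → AffineRing Γ.ideal l}
    (hbu : ∀ i, (b i : AffineRing Γ.ideal l) = u i)
    (hu : ∀ i < n, ∀ j < n, u i * u (j + 1) = u (i + 1) * u j) :
    Γ.LiesOnRationalNormalCurve := by
  let x : Fin (n + 1) → linearForms Γ.ideal l := fun j =>
    ⟨toAffine Γ.ideal l (X j), X j, isHomogeneous_X K j, rfl⟩
  have x_linearIndependent : LinearIndependent K x := by
    refine LinearIndependent.of_comp (linearForms Γ.ideal l).subtype ?_
    have span_eq : Submodule.span K (Set.range ((linearForms Γ.ideal l).subtype ∘ x)) =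
        linearForms Γ.ideal l := (linearForms_eq_span _ _).symm
    rw [linearIndependent_iff_card_eq_finrank_span, Set.finrank, Fintype.card_fin, span_eq,
      hV.finrank_eq]
  let F : Fin (n + 1) → MvPolynomial (Fin 2) K := fun j => b.constr K (binaryMonomial K n) (x j)
  have F_homogeneous : ∀ j, (F j).IsHomogeneous n := fun j => by
    rw [← mem_homogeneousSubmodule]
    dsimp only [F]
    rw [Basis.constr_apply_fintype]
    exact Submodule.sum_mem _ fun i _ => Submodule.smul_mem _ _ (isHomogeneous_binaryMonomial i)
  have F_linearIndependent : LinearIndependent K F :=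
    x_linearIndependent.map' (b.constr K (binaryMonomial K n))
      (LinearMap.ker_eq_bot.mpr
        (b.injective_constr_of_linearIndependent linearIndependent_binaryMonomial))
  let C := imageOfForms hn F F_homogeneous fun hF => F_linearIndependent.ne_zero 0 (congrFun hF 0)
  refine ⟨C, ⟨F, F_homogeneous, F_linearIndependent, rfl⟩, fun f hf => ?_⟩
  rw [← sum_homogeneousComponent f]
  refine Ideal.sum_mem _ fun k _ => ?_
  have hk := homogeneousComponent_isHomogeneous k f
  rw [mem_ideal_iff D hk, aeval_unique (toAffine Γ.ideal l)]
  exact aeval_eq_zero_of_minors b hV.one_mem hbu hu (x := x) hk (C.homogeneous f hf k)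

theorem liesOnRationalNormalCurve_of_minors (hn : 1 ≤ n) (D : InvertibleForm Γ.ideal l)
    (hV : IsLinearlyGeneral n (linearForms Γ.ideal l)) {u : ℕ → AffineRing Γ.ideal l}
    (huV : ∀ i ≤ n, u i ∈ linearForms Γ.ideal l)
    (hli : LinearIndependent K fun i : Fin (n + 1) => u i)
    (hu : ∀ i < n, ∀ j < n, u i * u (j + 1) = u (i + 1) * u j) :
    Γ.LiesOnRationalNormalCurve := by
  let b : Basis (Fin (n + 1)) K (linearForms Γ.ideal l) :=
    basisOfLinearIndependentOfCardEqFinrank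
      (b := fun i : Fin (n + 1) => ⟨u i, huV i (by omega)⟩)
      (LinearIndependent.of_comp (linearForms Γ.ideal l).subtype hli)
      (by rw [hV.finrank_eq, Fintype.card_fin])
  exact liesOnRationalNormalCurve_of_basis hn D hV b (fun i => by simp [b]) hu

end ClosedSubscheme

end RationalNormalCurve

section Evaluation

variable {K : Type*} [Field K] {σ ι : Type*}

/-- Evaluation of polynomials at a family of points of affine space. -/
def evalPoints (w : ι → σ → K) : MvPolynomial σ K →ₐ[K] (ι → K) :=
  AlgHom.pi fun p => aeval (w p)

@[simp]
theorem evalPoints_apply (w : ι → σ → K) (f : MvPolynomial σ K) (p : ι) :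
    evalPoints w f p = eval (w p) f :=
  DFunLike.congr_fun (coe_aeval_eq_eval (w p)) f

theorem map_evalPoints_eq_top_iff [Finite ι] (w : ι → σ → K) (U : Submodule K (MvPolynomial σ K)) :
    U.map (evalPoints w).toLinearMap = ⊤ ↔
      ∀ p, ∃ f ∈ U, eval (w p) f ≠ 0 ∧ ∀ p' ≠ p, eval (w p') f = 0 := by
  classical
  constructor
  · intro htop p
    obtain ⟨f, hf, hfp⟩ : Pi.single p (1 : K) ∈ U.map (evalPoints w).toLinearMap :=
      htop ▸ Submodule.mem_top
    have eval_f : ∀ p', eval (w p') f = (Pi.single p 1 : ι → K) p' := fun p' => by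
      rw [← hfp, AlgHom.toLinearMap_apply, evalPoints_apply]
    refine ⟨f, hf, ?_, fun p' hp' => ?_⟩
    · rw [eval_f, Pi.single_eq_same]
      exact one_ne_zero
    · rw [eval_f, Pi.single_eq_of_ne hp']
  · intro hsep
    rw [eq_top_iff, ← (Pi.basisFun K ι).span_eq, Submodule.span_le]
    rintro _ ⟨p, rfl⟩
    obtain ⟨f, hf, hfp, hf0⟩ := hsep p
    refine ⟨(eval (w p) f)⁻¹ • f, U.smul_mem _ hf, funext fun p' => ?_⟩
    rw [AlgHom.toLinearMap_apply, evalPoints_apply, smul_eval, Pi.basisFun_apply]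
    by_cases hp' : p' = p
    · rw [hp', inv_mul_cancel₀ hfp, Pi.single_eq_same]
    · rw [hf0 p' hp', mul_zero, Pi.single_eq_of_ne hp']

theorem evalPoints_surjective [Finite ι] {w : ι → σ → K} (hw : Function.Injective w) :
    Function.Surjective (evalPoints w) := by
  classical
  have := Fintype.ofFinite ι
  have exists_separating : ∀ p p', p' ≠ p →
      ∃ g : MvPolynomial σ K, eval (w p) g ≠ 0 ∧ eval (w p') g = 0 := fun p p' hne => by
    obtain ⟨j, hj⟩ := Function.ne_iff.mp (hw.ne hne)
    refine ⟨X j - C (w p' j), ?_, ?_⟩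
    · simpa only [map_sub, eval_X, eval_C, sub_ne_zero] using hj.symm
    · rw [map_sub, eval_X, eval_C, sub_self]
  choose! g hg hg0 using exists_separating
  suffices LinearMap.range (evalPoints w).toLinearMap = ⊤ from LinearMap.range_eq_top.mp this
  rw [LinearMap.range_eq_map, map_evalPoints_eq_top_iff]
  refine fun p => ⟨∏ p' ∈ Finset.univ.erase p, g p p', trivial, ?_, fun p' hp' => ?_⟩
  · rw [map_prod, Finset.prod_ne_zero_iff]
    exact fun p' hp' => hg p p' (Finset.ne_of_mem_erase hp')
  · rw [map_prod]
    exact Finset.prod_eq_zero (Finset.mem_erase.mpr ⟨hp', Finset.mem_univ _⟩) (hg0 p p' hp')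

end Evaluation

section Points

variable {K : Type*} [Field K] {n : ℕ} {Y : Finset (ℙ K (Fin (n + 1) → K))}

theorem eval_smul_rep_eq_zero_of_mem_pointsIdeal {f : CoordRing K n} (hf : f ∈ pointsIdeal Y)
    {p : ℙ K (Fin (n + 1) → K)} (hp : p ∈ Y) (c : K) : eval (c • p.rep) f = 0 := by
  rw [← coe_aeval_eq_eval]
  refine hf _ (Set.mem_iUnion₂.mpr ⟨p, hp, ?_⟩)
  rw [SetLike.mem_coe, Projectivization.submodule_eq]
  exact Submodule.smul_mem _ _ (Submodule.mem_span_singleton_self _)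

theorem mem_pointsIdeal_iff {f : CoordRing K n} {k : ℕ} (hf : f.IsHomogeneous k) :
    f ∈ pointsIdeal Y ↔ ∀ p ∈ Y, eval p.rep f = 0 := by
  refine ⟨fun hfY p hp => ?_, fun hfY x hx => ?_⟩
  · simpa using eval_smul_rep_eq_zero_of_mem_pointsIdeal hfY hp 1
  · obtain ⟨p, hp, hx⟩ := Set.mem_iUnion₂.mp hx
    rw [SetLike.mem_coe, Projectivization.submodule_eq] at hx
    obtain ⟨c, rfl⟩ := Submodule.mem_span_singleton.mp hx
    have eval_eq_zero : eval (c • p.rep) f = 0 := by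
      rw [eval_smul_of_isHomogeneous hf, hfY p hp, mul_zero]
    rwa [← coe_aeval_eq_eval] at eval_eq_zero

theorem pointsIdeal_anti {S : Finset (ℙ K (Fin (n + 1) → K))} (hYS : Y ⊆ S) :
    pointsIdeal S ≤ pointsIdeal Y :=
  fun _ hf x hx => hf x (Set.biUnion_subset_biUnion_left hYS hx)

theorem hilbertFunction_pointsIdeal (Y : Finset (ℙ K (Fin (n + 1) → K))) {c : Y → K}
    (hc : ∀ p, c p ≠ 0) (k : ℕ) :
    hilbertFunction (pointsIdeal Y) k = finrank K ((homogeneousSubmodule (Fin (n + 1)) K k).map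
      (evalPoints fun p : Y => c p • p.1.rep).toLinearMap) := by
  refine finrank_map_eq_of_forall_iff _ _ _ fun f hf => ?_
  have mk_eq_zero : (Ideal.Quotient.mkₐ K (pointsIdeal Y)).toLinearMap f = 0 ↔
      f ∈ pointsIdeal Y := Ideal.Quotient.eq_zero_iff_mem
  rw [mk_eq_zero, mem_pointsIdeal_iff hf, AlgHom.toLinearMap_apply, funext_iff]
  simp only [evalPoints_apply, eval_smul_of_isHomogeneous hf, Pi.zero_apply, mul_eq_zero,
    pow_eq_zero_iff', hc, false_and, false_or, Subtype.forall]

theorem hilbertFunction_pointsIdeal_eq_finrank (Y : Finset (ℙ K (Fin (n + 1) → K))) (k : ℕ) :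
    hilbertFunction (pointsIdeal Y) k = finrank K ((homogeneousSubmodule (Fin (n + 1)) K k).map
      (evalPoints fun p : Y => p.1.rep).toLinearMap) := by
  have h := hilbertFunction_pointsIdeal Y (c := fun _ => (1 : K)) (fun _ => one_ne_zero) k
  have hone : (fun p : Y => (1 : K) • p.1.rep) = fun p => p.1.rep := funext fun p => one_smul K _
  rwa [hone] at h

theorem hilbertFunction_pointsIdeal_le_card (Y : Finset (ℙ K (Fin (n + 1) → K))) (k : ℕ) :
    hilbertFunction (pointsIdeal Y) k ≤ Y.card := by
  rw [hilbertFunction_pointsIdeal_eq_finrank]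
  refine (Submodule.finrank_le _).trans_eq ?_
  rw [finrank_fintype_fun_eq_card, Fintype.card_coe]

theorem hilbertFunction_pointsIdeal_eq_card_iff {k : ℕ} :
    hilbertFunction (pointsIdeal Y) k = Y.card ↔
      ∀ p ∈ Y, ∃ f : CoordRing K n, f.IsHomogeneous k ∧ eval p.rep f ≠ 0 ∧
        ∀ p' ∈ Y, p' ≠ p → eval p'.rep f = 0 := by
  have hcard : finrank K (Y → K) = Y.card := by
    rw [finrank_fintype_fun_eq_card, Fintype.card_coe]
  rw [hilbertFunction_pointsIdeal_eq_finrank, ← hcard]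
  have htop : ∀ U : Submodule K (Y → K), finrank K U = finrank K (Y → K) ↔ U = ⊤ := fun U =>
    ⟨Submodule.eq_top_of_finrank_eq, fun hU => by rw [hU, finrank_top]⟩
  rw [htop, map_evalPoints_eq_top_iff]
  simp only [Subtype.forall, mem_homogeneousSubmodule, ne_eq, Subtype.mk.injEq]

/-- The separating form of degree `a + b` for a point is the product of one of degree `a`, which
takes care of up to `s - 1` of the other points, and one of degree `b` for the remaining points. -/
theorem hilbertFunction_pointsIdeal_add_eq_card {a b s t : ℕ} (hs : 1 ≤ s) (ht : 1 ≤ t)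
    (ha : ∀ Z ⊆ Y, Z.card ≤ s → hilbertFunction (pointsIdeal Z) a = Z.card)
    (hb : ∀ Z ⊆ Y, Z.card ≤ t → hilbertFunction (pointsIdeal Z) b = Z.card)
    (hY : Y.card + 1 ≤ s + t) : hilbertFunction (pointsIdeal Y) (a + b) = Y.card := by
  classical
  refine hilbertFunction_pointsIdeal_eq_card_iff.mpr fun p hp => ?_
  have hcard_erase := Finset.card_erase_of_mem hp
  obtain ⟨W, hW, hWcard⟩ := Finset.exists_subset_card_eq
    (min_le_left (Y.erase p).card (s - 1))
  have hWY : W ⊆ Y := hW.trans (Finset.erase_subset _ _)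
  have hpW : p ∉ W := fun hpW => Finset.notMem_erase p Y (hW hpW)
  have hcard_insert := Finset.card_insert_of_notMem hpW
  have hcard_sdiff := Finset.card_sdiff_of_subset hWY
  obtain ⟨f, hf, hfp, hf0⟩ := hilbertFunction_pointsIdeal_eq_card_iff.mp
    (ha (insert p W) (Finset.insert_subset hp hWY) (by omega)) p (Finset.mem_insert_self _ _)
  obtain ⟨g, hg, hgp, hg0⟩ := hilbertFunction_pointsIdeal_eq_card_iff.mp
    (hb (Y \ W) Finset.sdiff_subset (by omega)) p (Finset.mem_sdiff.mpr ⟨hp, hpW⟩)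
  refine ⟨f * g, hf.mul hg, ?_, fun p' hp' hne => ?_⟩
  · rw [map_mul]
    exact mul_ne_zero hfp hgp
  · rw [map_mul]
    by_cases hp'W : p' ∈ W
    · rw [hf0 p' (Finset.mem_insert_of_mem hp'W) hne, zero_mul]
    · rw [hg0 p' (Finset.mem_sdiff.mpr ⟨hp', hp'W⟩) hne, mul_zero]

theorem IsInUniformPosition.min_le_hilbertFunction_add {S : Finset (ℙ K (Fin (n + 1) → K))}
    (hS : IsInUniformPosition S) {a b : ℕ} (ha : 1 ≤ hilbertFunction (pointsIdeal S) a)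
    (hb : 1 ≤ hilbertFunction (pointsIdeal S) b) :
    min S.card (hilbertFunction (pointsIdeal S) a + hilbertFunction (pointsIdeal S) b - 1) ≤
      hilbertFunction (pointsIdeal S) (a + b) := by
  obtain ⟨Y, hYS, hYcard⟩ := Finset.exists_subset_card_eq (min_le_left S.card
    (hilbertFunction (pointsIdeal S) a + hilbertFunction (pointsIdeal S) b - 1))
  have subset_eq_card : ∀ k, ∀ Z ⊆ Y, Z.card ≤ hilbertFunction (pointsIdeal S) k →
      hilbertFunction (pointsIdeal Z) k = Z.card := fun k Z hZ hk => by
    rw [hS.2 Z (hZ.trans hYS), min_eq_left hk]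
  have hY := hilbertFunction_pointsIdeal_add_eq_card ha hb (subset_eq_card a) (subset_eq_card b)
    (by omega)
  rw [hS.2 Y hYS] at hY
  rw [← hYcard, ← hY]
  exact min_le_right _ _

theorem eq_mul_three_add_one_of_superadditive {h : ℕ → ℕ} {d n q r : ℕ}
    (hadd : ∀ a b, min d (h a + h b - 1) ≤ h (a + b)) (hmin : ∀ k, min d (n * k + 1) ≤ h k)
    (hdq : d = n * q + r + 2) (hr : 3 * (r + 1) ≤ q) (hlt : h q < d) : h 3 = n * 3 + 1 := by
  by_contra hne
  obtain ⟨c, rfl⟩ := Nat.exists_eq_add_of_le hr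
  have hnq : n * (3 * (r + 1) + c) = (r + 1) * (n * 3) + n * c := by ring
  have hn3 : n * 3 ≤ (r + 1) * (n * 3) := Nat.le_mul_of_pos_left _ r.succ_pos
  have hthree : n * 3 + 2 ≤ h 3 := by
    have := hmin 3
    omega
  have hblocks : ∀ j, min d (j * (n * 3 + 1) + 1) ≤ h (3 * j) := by
    intro j
    induction j with
    | zero => simpa using hmin 0
    | succ j ih =>
      have hstep := hadd (3 * j) 3
      rw [← mul_add_one] at hstep
      rw [add_one_mul j]
      omega
  have hsum := hadd (3 * (r + 1)) c
  have hfirst := hblocks (r + 1)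
  have hlast := hmin c
  rw [mul_add_one (r + 1)] at hfirst
  omega

end Points

section AffineRepresentative

variable {K : Type*} [Field K] {n : ℕ} {Y : Finset (ℙ K (Fin (n + 1) → K))}
  {J : Ideal (CoordRing K n)} {l : CoordRing K n}

/-- The representative of a point of `ℙⁿ` on the affine hyperplane `l = 1`; it is the junk value `0`
if the linear form `l` vanishes at the point. -/
def affineRep (l : CoordRing K n) (p : ℙ K (Fin (n + 1) → K)) : Fin (n + 1) → K :=
  (eval p.rep l)⁻¹ • p.rep

theorem submodule_eq_span_affineRep {p : ℙ K (Fin (n + 1) → K)} (hl : eval p.rep l ≠ 0) :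
    p.submodule = K ∙ affineRep l p := by
  rw [Projectivization.submodule_eq]
  exact (Submodule.span_singleton_smul_eq (IsUnit.mk0 _ (inv_ne_zero hl)) _).symm

theorem affineRep_injective (hl : ∀ p : Y, eval p.1.rep l ≠ 0) :
    Function.Injective fun p : Y => affineRep l p.1 := fun p p' hpp' => by
  refine Subtype.ext (Projectivization.submodule_injective ?_)
  rw [submodule_eq_span_affineRep (hl p), submodule_eq_span_affineRep (hl p')]
  exact congrArg (K ∙ ·) hpp'

theorem InvertibleForm.eval_rep_ne_zero (D : InvertibleForm J l) (hJ : J ≤ pointsIdeal Y)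
    {p : ℙ K (Fin (n + 1) → K)} (hp : p ∈ Y) : eval p.rep l ≠ 0 := by
  intro hl
  refine p.rep_nonzero (funext fun i => ?_)
  have := eval_smul_rep_eq_zero_of_mem_pointsIdeal (hJ (D.sub_mem i)) hp 1
  simpa [hl] using this

theorem affineIdeal_le_ker_evalPoints (D : InvertibleForm J l) (hJ : J ≤ pointsIdeal Y) :
    affineIdeal J l ≤ RingHom.ker (evalPoints fun p : Y => affineRep l p.1) := by
  refine sup_le (fun f hf => ?_) (Ideal.span_le.mpr (Set.singleton_subset_iff.mpr ?_))
  · exact funext fun p => (evalPoints_apply _ f p).trans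
      (eval_smul_rep_eq_zero_of_mem_pointsIdeal (hJ hf) p.2 _)
  · change evalPoints (fun p : Y => affineRep l p.1) (l - 1) = 0
    funext p
    rw [evalPoints_apply, map_sub, affineRep, eval_smul_of_isHomogeneous D.isHomogeneous, pow_one,
      inv_mul_cancel₀ (D.eval_rep_ne_zero hJ p.2), map_one, sub_self, Pi.zero_apply]

theorem InvertibleForm.min_card_le_hilbertFunction [IsAlgClosed K] (D : InvertibleForm J l)
    [Module.Finite K (AffineRing J l)] (hV : IsLinearlyGeneral n (linearForms J l))
    (hJ : J ≤ pointsIdeal Y) (k : ℕ) :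
    min Y.card (n * k + 1) ≤ hilbertFunction (pointsIdeal Y) k := by
  have hl : ∀ p : Y, eval p.1.rep l ≠ 0 := fun p => D.eval_rep_ne_zero hJ p.2
  let evalAffine : AffineRing J l →ₐ[K] (Y → K) :=
    Ideal.Quotient.liftₐ _ (evalPoints fun p : Y => affineRep l p.1)
      fun _ hf => affineIdeal_le_ker_evalPoints D hJ hf
  have evalAffine_surjective : Function.Surjective evalAffine := fun v => by
    obtain ⟨f, hf⟩ := evalPoints_surjective (affineRep_injective hl) v
    exact ⟨toAffine J l f, hf⟩
  have hcard : finrank K (Y → K) = Y.card := by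
    rw [finrank_fintype_fun_eq_card, Fintype.card_coe]
  have hH : hilbertFunction (pointsIdeal Y) k =
      finrank K ((linearForms J l ^ k).map evalAffine.toLinearMap) := by
    rw [hilbertFunction_pointsIdeal Y (fun p => inv_ne_zero (hl p)), linearForms_pow,
      ← Submodule.map_comp]
    rfl
  rw [hH, ← hcard]
  exact hV.min_le_finrank_map_pow evalAffine_surjective k

end AffineRepresentative

section FiniteSubschemes

variable {K : Type*} [Field K] {n : ℕ} {Γ : ClosedSubscheme K n} {l : CoordRing K n}

namespace ClosedSubscheme

theorem min_le_hilbertFunction [IsAlgClosed K] (D : InvertibleForm Γ.ideal l)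
    [Module.Finite K (AffineRing Γ.ideal l)] (hV : IsLinearlyGeneral n (linearForms Γ.ideal l))
    (k : ℕ) :
    min (finrank K (AffineRing Γ.ideal l)) (n * k + 1) ≤ hilbertFunction Γ.ideal k := by
  rw [hilbertFunction_eq D, ← Submodule.map_id (linearForms Γ.ideal l ^ k)]
  exact hV.min_le_finrank_map_pow (ψ := AlgHom.id K _) Function.surjective_id k

theorem liesOnRationalNormalCurve_of_hilbertFunction_eq [IsAlgClosed K] (hn : 1 ≤ n)
    (D : InvertibleForm Γ.ideal l) [Module.Finite K (AffineRing Γ.ideal l)]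
    (hV : IsLinearlyGeneral n (linearForms Γ.ideal l)) {k : ℕ} (hk : 3 ≤ k)
    (hd : n * k + 2 ≤ finrank K (AffineRing Γ.ideal l))
    (hH : hilbertFunction Γ.ideal k = n * k + 1) : Γ.LiesOnRationalNormalCurve := by
  rw [hilbertFunction_eq D] at hH
  obtain ⟨u, huV, hli, hu⟩ := hV.exists_minors_eq_zero hn hk hH hd
  exact liesOnRationalNormalCurve_of_minors hn D hV huV hli hu

theorem exists_h1_eq (hn : 1 ≤ n) (D : InvertibleForm Γ.ideal l) {d : ℕ} (hd : Γ.degree = d)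
    (q : ℕ) : ∃ m : ℕ, h1 Γ.ideal q = m ∧ m + hilbertFunction Γ.ideal q = d := by
  have hsum := h1_add_hilbertFunction hn D q
  rw [hd] at hsum
  have hfin : h1 Γ.ideal q ≠ ⊤ := by
    intro htop
    simp [htop] at hsum
  obtain ⟨m, hm⟩ := ENat.ne_top_iff_exists.mp hfin
  rw [← hm] at hsum
  exact ⟨m, hm.symm, mod_cast hsum⟩

end ClosedSubscheme

variable {S : Finset (ℙ K (Fin (n + 1) → K))}

theorem isInUniformPosition_of_liesOnRationalNormalCurve [IsAlgClosed K] (hn : 1 ≤ n)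
    (hΓ : Γ.IsInLinearlyGeneralPosition) (D : InvertibleForm Γ.ideal l)
    [Module.Finite K (AffineRing Γ.ideal l)] (hS : Γ.ideal = pointsIdeal S)
    (hcurve : Γ.LiesOnRationalNormalCurve) : IsInUniformPosition S := by
  obtain ⟨C, hC, hΓC⟩ := hcurve
  have hilbert_eq : ∀ Y ⊆ S, ∀ k, hilbertFunction (pointsIdeal Y) k = min Y.card (n * k + 1) := by
    intro Y hYS k
    have hΓY : Γ.ideal ≤ pointsIdeal Y := hS.le.trans (pointsIdeal_anti hYS)
    exact le_antisymm (le_min (hilbertFunction_pointsIdeal_le_card Y k)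
      (hC.hilbertFunction_le (le_trans hΓC hΓY) k))
      (D.min_card_le_hilbertFunction (hΓ.isLinearlyGeneral hn D) hΓY k)
  refine ⟨fun f hf hf1 => ?_, fun Y hYS k => ?_⟩
  · exact Submodule.disjoint_def.mp (hΓ.disjoint_ker_toAffine hn D) f hf1
      (Ideal.Quotient.eq_zero_iff_mem.mpr (Ideal.mem_sup_left (hS ▸ hf)))
  · have := Finset.card_le_card hYS
    rw [hilbert_eq Y hYS, hilbert_eq S subset_rfl]
    omega

theorem IsInUniformPosition.hilbertFunction_three_eq (hS : IsInUniformPosition S) (hn : 1 ≤ n)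
    {d q r : ℕ} (hmin : ∀ k, min d (n * k + 1) ≤ hilbertFunction (pointsIdeal S) k)
    (hdq : d = n * q + r + 2) (hr : 3 * (r + 1) ≤ q)
    (hlt : hilbertFunction (pointsIdeal S) q < d) :
    hilbertFunction (pointsIdeal S) 3 = n * 3 + 1 := by
  have hcard : d ≤ S.card := by
    have := (hmin d).trans (hilbertFunction_pointsIdeal_le_card S d)
    have := Nat.le_mul_of_pos_left d hn
    omega
  have hpos : ∀ k, 1 ≤ hilbertFunction (pointsIdeal S) k := fun k => le_trans (by omega) (hmin k)
  exact eq_mul_three_add_one_of_superadditive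
    (fun a b => (min_le_min_right _ hcard).trans (hS.min_le_hilbertFunction_add (hpos a) (hpos b)))
    hmin hdq hr hlt

end FiniteSubschemes

end ProjSpace

end

open ProjSpace Module in
theorem theorem5p3_general {K : Type*} [Field K] [IsAlgClosed K] {n d q r : ℕ} (hn : 1 ≤ n)
    (Γ : ClosedSubscheme K n) (hfin : Γ.IsFinite) (hlin : Γ.IsInLinearlyGeneralPosition)
    (hdeg : Γ.degree = d) (hdq : d = n * q + r + 2) :
    h1 Γ.ideal q ≤ (r + 1 : ℕ) ∧
    (3 ≤ q → (Γ.LiesOnRationalNormalCurve ↔ h1 Γ.ideal q = (r + 1 : ℕ))) ∧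
    (3 * (r + 1) ≤ q → ∀ S : Finset (ℙ K (Fin (n + 1) → K)), Γ.ideal = pointsIdeal S →
      0 < h1 Γ.ideal q → (IsInUniformPosition S ↔ h1 Γ.ideal q = (r + 1 : ℕ))) := by
  obtain ⟨l, ⟨D⟩⟩ := hfin.exists_invertibleForm
  have := ClosedSubscheme.finite_affineRing D hdeg
  have hV := hlin.isLinearlyGeneral hn D
  have hmin := ClosedSubscheme.min_le_hilbertFunction D hV
  have hA : finrank K (AffineRing Γ.ideal l) = d := by
    exact_mod_cast (ClosedSubscheme.degree_eq_finrank D).symm.trans hdeg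
  rw [hA] at hmin
  obtain ⟨m, hm, hmd⟩ := ClosedSubscheme.exists_h1_eq hn D hdeg q
  have hminq := hmin q
  have eq_of_curve : Γ.LiesOnRationalNormalCurve → m = r + 1 := by
    rintro ⟨C, hC, hΓC⟩
    have := hC.hilbertFunction_le hΓC q
    omega
  have curve_of_hilbert : ∀ k, 3 ≤ k → k ≤ q → hilbertFunction Γ.ideal k = n * k + 1 →
      Γ.LiesOnRationalNormalCurve := fun k hk hkq =>
    ClosedSubscheme.liesOnRationalNormalCurve_of_hilbertFunction_eq hn D hV hk
      (by have := Nat.mul_le_mul_left n hkq; omega)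
  have curve_of_eq : 3 ≤ q → m = r + 1 → Γ.LiesOnRationalNormalCurve := fun hq h =>
    curve_of_hilbert q hq le_rfl (by omega)
  rw [hm]
  simp only [Nat.cast_inj, Nat.cast_le, Nat.cast_pos]
  refine ⟨by omega, fun hq => ⟨eq_of_curve, curve_of_eq hq⟩, fun hr S hS hpos => ⟨fun hU => ?_,
    fun h => isInUniformPosition_of_liesOnRationalNormalCurve hn hlin D hS
      (curve_of_eq (by omega) h)⟩⟩
  refine eq_of_curve (curve_of_hilbert 3 le_rfl (by omega) ?_)
  rw [hS] at hmin hmd ⊢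
  exact hU.hilbertFunction_three_eq hn hmin hdq hr (by omega)

theorem theorem5p3 {K : Type*} [Field K] [IsAlgClosed K] [CharZero K] {n d q r : ℕ} (hn : 2 ≤ n)
    (Γ : ProjSpace.ClosedSubscheme K n) (hfin : Γ.IsFinite)
    (hlin : Γ.IsInLinearlyGeneralPosition) (hdeg : Γ.degree = (d : ℕ∞))
    (hd : 4 * n ^ 2 + 6 * n + 1 ≤ d) (hdq : d = n * q + r + 2) (hr : r ≤ n - 1) :
    ProjSpace.h1 Γ.ideal q ≤ ((r + 1 : ℕ) : ℕ∞) ∧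
    (Γ.LiesOnRationalNormalCurve ↔ ProjSpace.h1 Γ.ideal q = ((r + 1 : ℕ) : ℕ∞)) ∧
    (∀ S : Finset (Projectivization K (Fin (n + 1) → K)),
      Γ.ideal = ProjSpace.pointsIdeal S → 0 < ProjSpace.h1 Γ.ideal q →
        (ProjSpace.IsInUniformPosition S ↔
          ProjSpace.h1 Γ.ideal q = ((r + 1 : ℕ) : ℕ∞))) := by
  have hq : 4 * n + 5 ≤ q := by
    by_contra hlt
    have hnq : n * q ≤ n * (4 * n + 4) := Nat.mul_le_mul_left n (by omega)
    have hsq : n * (4 * n + 4) = 4 * n ^ 2 + 4 * n := by ring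
    omega
  obtain ⟨hle, hcurve, huniform⟩ := theorem5p3_general (by omega) Γ hfin hlin hdeg hdq
  exact ⟨hle, hcurve (by omega), huniform (by omega)⟩
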